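/- Let $n\ge 4$ be an integer and put $$\varepsilon=\frac1{n-1},\qquad \delta=\frac{n+2}{n-1},\qquad \kappa=\frac1{\sqrt\pi},\qquad \kappa_3=-\frac{\kappa}{12},\qquad \lambda=\left(\frac{\delta(\delta+1)}{(2\kappa)^n}\right)^{1/(n-1)},$$ $$\mu_1(y)=\operatorname{erf}\left(\frac y2\right)=\frac2{\sqrt\pi}\int_0^{y/2}e^{-\sigma^2}\,d\sigma .$$ Then there exists a unique positive, twice differentiable function $\mu_2\colon(0,\infty)\to\mathbf R$ such that $$\mu_2''(y)+\tfrac12\,y\,\mu_2'(y)+\varepsilon\mu_2(y)=\bigl(2\mu_1(y)\mu_2(y)\bigr)^n\quad\text{for all }y>0,\qquad \lim_{y\to0^+}\mu_2(y)\,y^{\delta}=\lambda,\qquad \lim_{y\to\infty}\mu_2(y)\,y^{2\varepsilon}=0 .$$ Moreover, as $y\to0^+$, $$\mu_2(y)=\lambda y^{-\delta}+\lambda_0y^{2-\delta}+\lambda_1y^{4-\delta}+o\bigl(y^{4-\delta}\bigr),$$ where $$\lambda_0=\frac12\,\frac{\lambda}{\kappa}\,\frac{-2n\kappa_3\delta(\delta+1)-\kappa(\delta-2\varepsilon)}{(n-1)\delta(\delta+1)+2(2\delta-1)}>0$$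 and $\lambda_1\neq0$ is some constant; and, as $y\to\infty$, $$\mu_2(y)=e^{-y^2/4}\left(\frac{C}{y^{1-2\varepsilon}}+o\bigl(y^{-(1-2\varepsilon)}\bigr)\right)$$ for some constant $C>0$. -/

import Mathlib

open Filter Topology

noncomputable section

namespace ReactionFront

/-- `ε = 1 / (n - 1)`. -/
def eps (n : ℕ) : ℝ := 1 / ((n : ℝ) - 1)

/-- `δ = (n + 2) / (n - 1)`. -/
def del (n : ℕ) : ℝ := ((n : ℝ) + 2) / ((n : ℝ) - 1)

/-- `κ = 1 / √π`, the coefficient of `y` in the Taylor expansion of `μ₁` at zero. -/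
def kap : ℝ := 1 / Real.sqrt Real.pi

/-- `κ₃ = - κ / 12`, the coefficient of `y ^ 3` in the Taylor expansion of `μ₁` at zero. -/
def kap3 : ℝ := -(1 / 12) * kap

/-- `λ = (δ (δ + 1) / (2 κ) ^ n) ^ (1 / (n - 1))`. -/
def lam (n : ℕ) : ℝ :=
  (del n * (del n + 1) / (2 * kap) ^ n) ^ (1 / ((n : ℝ) - 1))

/-- The coefficient `λ₀`. -/
def lam0 (n : ℕ) : ℝ :=
  1 / 2 * (lam n / kap) *
    ((-2 * (n : ℝ) * kap3 * del n * (del n + 1) - kap * (del n - 2 * eps n)) /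
      (((n : ℝ) - 1) * del n * (del n + 1) + 2 * (2 * del n - 1)))

/-- `μ₁(y) = erf (y / 2) = (2 / √π) ∫_0^{y/2} exp (-σ²) dσ`. -/
def mu1 (y : ℝ) : ℝ :=
  2 / Real.sqrt Real.pi * ∫ σ in (0 : ℝ)..(y / 2), Real.exp (-σ ^ 2)

/-- `f(x) = ∑ i, c i * x ^ (p i) + …` near `x = 0`, where `p 0 < p 1 < … < p k`: the error is
`o (x ^ (p k))` as `x → 0⁺`. -/
def HasExpansionNearZero {k : ℕ} (f : ℝ → ℝ) (c p : Fin (k + 1) → ℝ) : Prop :=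
  StrictMono p ∧
    Tendsto (fun x : ℝ => 1 / x ^ p (Fin.last k) * |f x - ∑ i, c i * x ^ p i|)
      (𝓝[>] 0) (𝓝 0)

/-- `f(x) = ∑ i, c i * x ^ (- p i) + …` near `x = ∞`, where `p 0 < p 1 < … < p k`: the error is
`o (x ^ (- p k))` as `x → ∞`. -/
def HasExpansionNearInfinity {k : ℕ} (f : ℝ → ℝ) (c p : Fin (k + 1) → ℝ) : Prop :=
  StrictMono p ∧
    Tendsto (fun x : ℝ => x ^ p (Fin.last k) * |f x - ∑ i, c i * x ^ (-p i)|)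
      atTop (𝓝 0)

/-- `μ`, regarded as a function on the open half-line `(0, ∞)` (its values elsewhere play no
role), is a positive, twice differentiable solution of
`μ'' + (y / 2) μ' + ε μ = (2 μ₁ μ) ^ n` with `μ(y) y ^ δ → λ` as `y → 0⁺` and
`μ(y) y ^ (2 ε) → 0` as `y → ∞`. -/
structure IsPositiveSolution (n : ℕ) (μ : ℝ → ℝ) : Prop where
  pos : ∀ y : ℝ, 0 < y → 0 < μ y
  differentiable : DifferentiableOn ℝ μ (Set.Ioi 0)
  differentiable_deriv : DifferentiableOn ℝ (deriv μ) (Set.Ioi 0)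
  ode : ∀ y : ℝ, 0 < y →
    deriv (deriv μ) y + 1 / 2 * y * deriv μ y + eps n * μ y = (2 * mu1 y * μ y) ^ n
  at_zero : Tendsto (fun y : ℝ => μ y * y ^ del n) (𝓝[>] 0) (𝓝 (lam n))
  at_infinity : Tendsto (fun y : ℝ => μ y * y ^ (2 * eps n)) atTop (𝓝 0)

end ReactionFront

end

/-!
The equation for `μ` has a zero-order term `ε μ` of the wrong sign for the maximum principle. The
function `u = exp (y² / 4) μ` satisfies `u'' - (y / 2) u' = (1 / 2 - ε) u + coef(y) u ^ n` instead,
and since `ε < 1 / 2` the right-hand side (`force`) increases with `u ≥ 0`. Hence solutions can be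
compared with sub- and supersolutions, and with each other, by looking at an interior maximum of a
difference; the maximum principles of the first part are used throughout.

*Existence.* `λ y ^ (-δ)` is a subsolution (`force_lower_barrier`) and `λ y ^ (-δ) + B` is a
supersolution for a large constant `B` (`force_upper_barrier`; here `δ ≤ 2`, that is `n ≥ 4`, is
needed). On a compact interval, the boundary value problem is solved by shooting
(`exists_boundary_value`), and with the supersolution as boundary values its solution lies between
the barriers. As the interval grows these solutions decrease, and their limit solves the
equation on `(0, ∞)` (`exists_global_between_barriers`). The barriers agree to leading order at
zero, and they are bounded at infinity, so that both boundary conditions hold.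

*Expansion at zero.* The coefficients `λ₀`, `λ₁` are those for which the three-term sum `P`
satisfies the equation up to `O(y ^ (4 - δ))` (`approx_residual`). For any solution `μ`, the
difference `μ - P` is `o(y ^ (-δ))` and satisfies a linear equation whose potential is asymptotic to
`n δ (δ + 1) / y²`. As `n δ (δ + 1) > θ (θ - 1)` for `θ = 5 - δ`, multiples of `y ^ θ` are
supersolutions near zero, and `μ - P = O(y ^ θ)` (`IsPositiveSolution.abs_sub_approx_le`). That
`λ₁ ≠ 0` comes down to an integer polynomial in `n` without integer zeros (`relLam1_num_ne_zero`).

*Decay at infinity.* The linear equation has the growing supersolution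
`exp (y² / 4) (y ^ (-2 ε) + 2 y ^ (-2 ε - 2))` and a decaying one close to `y ^ (-(1 - 2 ε))`. The
condition at infinity says that `u` is negligible against the former, so `u` is bounded by a
multiple of the latter (`IsPositiveSolution.exp_mul_le`). Then the nonlinear term is negligible, and
a Wronskian argument shows that `u y ^ (1 - 2 ε)` is eventually increasing
(`IsPositiveSolution.exists_tendsto_atTop`).

*Uniqueness.* By the two expansions, the difference of two functions `u` coming from solutions tends
to zero at both ends of `(0, ∞)`, and the maximum principle applies (`IsPositiveSolution.le`).
-/

noncomputable section

namespace ReactionFront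

/-! ### Maximum principles -/

/-- Strict maximum principle for `d'' + b d'` on a compact interval. It suffices to control the
sign where `d` is positive; this is what makes it applicable to nonlinear problems. -/
theorem nonpos_of_strict_subsolution {α β : ℝ} {b d d' d'' : ℝ → ℝ}
    (hc : ContinuousOn d (Set.Icc α β))
    (h1 : ∀ y ∈ Set.Ioo α β, HasDerivAt d (d' y) y)
    (h2 : ∀ y ∈ Set.Ioo α β, HasDerivAt d' (d'' y) y)
    (hpos : ∀ y ∈ Set.Ioo α β, 0 < d y → 0 < d'' y + b y * d' y)
    (hα : d α ≤ 0) (hβ : d β ≤ 0) : ∀ y ∈ Set.Icc α β, d y ≤ 0 := by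
  intro y hy
  by_contra! hd
  obtain ⟨z, hz, hmax⟩ := isCompact_Icc.exists_isMaxOn ⟨y, hy⟩ hc
  have hzy : d y ≤ d z := hmax hy
  have hzpos : 0 < d z := hd.trans_le hzy
  have hzI : z ∈ Set.Ioo α β := by
    refine ⟨lt_of_le_of_ne hz.1 ?_, lt_of_le_of_ne hz.2 ?_⟩
    · rintro rfl
      exact absurd hα hzpos.not_ge
    · rintro rfl
      exact absurd hβ hzpos.not_ge
  have hnhds : Set.Ioo α β ∈ 𝓝 z := isOpen_Ioo.mem_nhds hzI
  have hlmax : IsLocalMax d z := hmax.isLocalMax (Icc_mem_nhds hzI.1 hzI.2)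
  have hd0 : d' z = 0 := hlmax.hasDerivAt_eq_zero (h1 z hzI)
  have hdd : 0 < d'' z := by simpa [hd0] using hpos z hzI hzpos
  have hev : deriv d =ᶠ[𝓝 z] d' := by
    filter_upwards [hnhds] with x hx using (h1 x hx).deriv
  have hdd' : deriv (deriv d) z = d'' z := by
    rw [hev.deriv_eq]
    exact (h2 z hzI).deriv
  have hlmin : IsLocalMin d z :=
    isLocalMin_of_deriv_deriv_pos (by rw [hdd']; exact hdd) (by rw [hev.eq_of_nhds, hd0])
      (h1 z hzI).continuousAt
  -- A point that is both a local minimum and a local maximum has a constant neighbourhood.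
  have hconst : d =ᶠ[𝓝 z] fun _ => d z := by
    filter_upwards [hlmax, hlmin] with x hx hx' using le_antisymm hx hx'
  have h0 : deriv d =ᶠ[𝓝 z] fun _ => 0 := by
    simpa using hconst.deriv
  have : deriv (deriv d) z = 0 := by
    rw [h0.deriv_eq]
    simp
  linarith

/-- Strict maximum principle on a set `U`, which need not be compact: the boundary condition says
that every point of `U` lies between two points where `d` is as small as desired. -/
theorem nonpos_of_strict_subsolution_of_ends {U : Set ℝ} {b d d' d'' : ℝ → ℝ}
    (h1 : ∀ y ∈ U, HasDerivAt d (d' y) y)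
    (h2 : ∀ y ∈ U, HasDerivAt d' (d'' y) y)
    (hpos : ∀ y ∈ U, 0 < d y → 0 < d'' y + b y * d' y)
    (hends : ∀ y ∈ U, ∀ c > 0, ∃ α β, α ≤ y ∧ y ≤ β ∧ Set.Icc α β ⊆ U ∧ d α ≤ c ∧ d β ≤ c) :
    ∀ y ∈ U, d y ≤ 0 := by
  intro y hy
  refine le_of_forall_pos_le_add fun c hc => ?_
  obtain ⟨α, β, hα, hβ, hU, hdα, hdβ⟩ := hends y hy c hc
  have := nonpos_of_strict_subsolution (b := b) (d := fun x => d x - c) (d' := d') (d'' := d'')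
    (α := α) (β := β)
    (fun x hx => ((h1 x (hU hx)).continuousAt.sub continuousAt_const).continuousWithinAt)
    (fun x hx => (h1 x (hU (Set.Ioo_subset_Icc_self hx))).sub_const c)
    (fun x hx => h2 x (hU (Set.Ioo_subset_Icc_self hx)))
    (fun x hx hdx => hpos x (hU (Set.Ioo_subset_Icc_self hx)) (by linarith))
    (by linarith) (by linarith) y ⟨hα, hβ⟩
  linarith

theorem hasDerivAt_exp_sq (s y : ℝ) :
    HasDerivAt (fun x : ℝ => Real.exp (s * x ^ 2)) (2 * s * y * Real.exp (s * y ^ 2)) y := by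
  have h : HasDerivAt (fun x : ℝ => s * x ^ 2) (2 * s * y) y := by
    have := (hasDerivAt_pow 2 y).const_mul s
    convert! this using 1
    ring
  convert! h.exp using 1
  ring

/-- Weak maximum principle for `d'' - (y / 2) d'`. -/
theorem nonpos_of_weak_subsolution {α β : ℝ} {d d' d'' : ℝ → ℝ}
    (hc : ContinuousOn d (Set.Icc α β))
    (h1 : ∀ y ∈ Set.Ioo α β, HasDerivAt d (d' y) y)
    (h2 : ∀ y ∈ Set.Ioo α β, HasDerivAt d' (d'' y) y)
    (hpos : ∀ y ∈ Set.Ioo α β, 0 < d y → 0 ≤ d'' y - y / 2 * d' y)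
    (hα : d α ≤ 0) (hβ : d β ≤ 0) : ∀ y ∈ Set.Icc α β, d y ≤ 0 := by
  -- `E = exp (y² / 2)` satisfies `E'' - (y / 2) E' > 0`, so that adding a small multiple of
  -- `E - max E` makes the inequality strict.
  set E : ℝ → ℝ := fun x => Real.exp (1 / 2 * x ^ 2) with hE
  have hE1 : ∀ y, HasDerivAt E (y * E y) y := fun y => by
    convert! hasDerivAt_exp_sq (1 / 2) y using 1
    simp only [hE]; ring
  have hE2 : ∀ y, HasDerivAt (fun x => x * E x) (E y + y * (y * E y)) y := fun y => by
    convert! (hasDerivAt_id y).mul (hE1 y) using 1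
    simp
  have hEpos : ∀ y, 0 < E y := fun y => Real.exp_pos _
  set m := E α + E β with hm
  have hEm : ∀ y ∈ Set.Icc α β, E y ≤ m := by
    intro y hy
    rcases le_or_gt 0 y with h | h
    · have : E y ≤ E β := Real.exp_le_exp.2 (by nlinarith [hy.2])
      linarith [hEpos α]
    · have : E y ≤ E α := Real.exp_le_exp.2 (by nlinarith [hy.1])
      linarith [hEpos β]
  have hEc : Continuous E := by fun_prop
  have hmpos : 0 < m := add_pos (hEpos _) (hEpos _)
  intro y hy
  refine le_of_forall_pos_le_add fun c hc' => ?_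
  set η := c / m with hη
  have hηpos : 0 < η := div_pos hc' hmpos
  have key := nonpos_of_strict_subsolution (b := fun y => -(y / 2))
    (d := fun x => d x + η * (E x - m)) (d' := fun x => d' x + η * (x * E x))
    (d'' := fun x => d'' x + η * (E x + x * (x * E x))) (α := α) (β := β)
    (hc.add (by fun_prop))
    (fun x hx => (h1 x hx).add (((hE1 x).sub_const m).const_mul η))
    (fun x hx => (h2 x hx).add ((hE2 x).const_mul η))
    (fun x hx hdx => by
      have hx' := hEm x (Set.Ioo_subset_Icc_self hx)
      have hd : 0 < d x := by
        by_contra! h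
        have : η * (E x - m) ≤ 0 := mul_nonpos_of_nonneg_of_nonpos hηpos.le (by linarith)
        linarith
      have h := hpos x hx hd
      have h' : 0 < η * (E x * (1 + x ^ 2 / 2)) :=
        mul_pos hηpos (mul_pos (hEpos x) (by positivity))
      nlinarith [h, h'])
    (by
      have := hEm α ⟨le_rfl, hy.1.trans hy.2⟩
      have : η * (E α - m) ≤ 0 := mul_nonpos_of_nonneg_of_nonpos hηpos.le (by linarith)
      linarith)
    (by
      have := hEm β ⟨hy.1.trans hy.2, le_rfl⟩
      have : η * (E β - m) ≤ 0 := mul_nonpos_of_nonneg_of_nonpos hηpos.le (by linarith)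
      linarith) y hy
  have h3 : η * m = c := by rw [hη]; field_simp
  have h4 : 0 < η * E y := mul_pos hηpos (hEpos y)
  nlinarith

/-! ### The parameters -/

section Parameters

variable {n : ℕ}

theorem cast_ge_four (hn : 4 ≤ n) : (4 : ℝ) ≤ n := by exact_mod_cast hn

theorem sub_one_mul_eps (hn : 4 ≤ n) : ((n : ℝ) - 1) * eps n = 1 := by
  have := cast_ge_four hn
  have h : (n : ℝ) - 1 ≠ 0 := by linarith
  rw [eps]; field_simp

theorem eps_pos (hn : 4 ≤ n) : 0 < eps n := by
  have := cast_ge_four hn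
  exact one_div_pos.2 (by linarith)

theorem eps_le (hn : 4 ≤ n) : eps n ≤ 1 / 3 := by
  have := cast_ge_four hn
  have h := sub_one_mul_eps hn
  have := eps_pos hn
  nlinarith

theorem del_eq (hn : 4 ≤ n) : del n = 1 + 3 * eps n := by
  have := cast_ge_four hn
  have h : (n : ℝ) - 1 ≠ 0 := by linarith
  rw [eps, del]; field_simp; ring

theorem one_lt_del (hn : 4 ≤ n) : 1 < del n := by
  have := eps_pos hn
  linarith [del_eq hn]

theorem del_le_two (hn : 4 ≤ n) : del n ≤ 2 := by
  have := eps_le hn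
  linarith [del_eq hn]

/-- The exponents of `y` on the two sides of the equation agree for `μ = λ y ^ (-δ)`. -/
theorem cast_mul_del (hn : 4 ≤ n) : (n : ℝ) * del n = n + del n + 2 := by
  rw [del_eq hn]
  linarith [sub_one_mul_eps hn]

theorem kap_pos : 0 < kap := one_div_pos.2 (Real.sqrt_pos.2 Real.pi_pos)

theorem del_mul_pos (hn : 4 ≤ n) : 0 < del n * (del n + 1) := by
  have := one_lt_del hn
  positivity

theorem lam_pos (hn : 4 ≤ n) : 0 < lam n := by
  have := kap_pos
  have := del_mul_pos hn
  exact Real.rpow_pos_of_pos (by positivity) _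

/-- The coefficients of `y` on the two sides of the equation agree for `μ = λ y ^ (-δ)`. -/
theorem lam_pow (hn : 4 ≤ n) : (2 * kap) ^ n * lam n ^ (n - 1) = del n * (del n + 1) := by
  have h2 := kap_pos
  have h3 := del_mul_pos hn
  have h : (1 / ((n : ℝ) - 1)) = ((n - 1 : ℕ) : ℝ)⁻¹ := by
    rw [Nat.cast_sub (by omega)]; simp
  rw [lam, h, Real.rpow_inv_natCast_pow (by positivity) (by omega)]
  field_simp

theorem lam_pow' (hn : 4 ≤ n) :
    (2 * kap) ^ n * lam n ^ n = del n * (del n + 1) * lam n := by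
  rw [← lam_pow hn, mul_assoc, ← pow_succ, Nat.sub_add_cancel (by omega)]

theorem lam0_pos (hn : 4 ≤ n) : 0 < lam0 n := by
  have h1 := lam_pos hn
  have h2 := kap_pos
  have h3 := one_lt_del hn
  have h4 := cast_ge_four hn
  have h5 := eps_pos hn
  have h6 := eps_le hn
  have h7 := del_eq hn
  have h8 := sub_one_mul_eps hn
  refine mul_pos (by positivity) (div_pos ?_ ?_)
  · have hb : 2 < del n * (del n + 1) := by nlinarith
    have : (8 : ℝ) < n * (del n * (del n + 1)) := by nlinarith
    have h9 : 0 < n * (del n * (del n + 1)) / 6 - (del n - 2 * eps n) := by linarith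
    have := mul_pos h2 h9
    rw [kap3]
    nlinarith
  · have : 0 < ((n : ℝ) - 1) * del n * (del n + 1) :=
      mul_pos (mul_pos (by linarith) (by linarith)) (by linarith)
    linarith

/-- `λ₀ / λ`. -/
def relLam0 (n : ℕ) : ℝ := lam0 n / lam n

/-- The equation satisfied by the coefficient of `y ^ (-δ)` of a solution. -/
theorem relLam0_eq (hn : 4 ≤ n) :
    (2 - del n) * (1 - del n) * relLam0 n - del n / 2 + eps n
      = del n * (del n + 1) * (n * (relLam0 n - 1 / 12)) := by
  have h1 := lam_pos hn
  have h2 := kap_pos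
  have h3 := one_lt_del hn
  have h4 := cast_ge_four hn
  have : 0 < ((n : ℝ) - 1) * del n * (del n + 1) :=
      mul_pos (mul_pos (by linarith) (by linarith)) (by linarith)
  have h5 : ((n : ℝ) - 1) * del n * (del n + 1) + 2 * (2 * del n - 1) ≠ 0 := by
    have : 0 < 2 * (2 * del n - 1) := by linarith
    positivity
  have h6 : relLam0 n = (n * (del n * (del n + 1)) / 12 - del n / 2 + eps n) /
      (((n : ℝ) - 1) * del n * (del n + 1) + 2 * (2 * del n - 1)) := by
    rw [relLam0, lam0, kap3, div_eq_iff h1.ne', eq_comm, div_mul_eq_mul_div, div_eq_iff h5,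
      mul_assoc, div_mul_cancel₀ _ h5]
    have hk := h2.ne'
    field_simp
    ring
  rw [eq_div_iff h5] at h6
  linarith

/-- `λ₁ / λ`, the solution of the equation for the coefficient of `y ^ (2 - δ)`. -/
def relLam1 (n : ℕ) : ℝ :=
  -(del n * (del n + 1) * (n * (1 / 160 - relLam0 n / 12)
      + n * (n - 1) / 2 * (relLam0 n - 1 / 12) ^ 2)
      - (2 - del n) / 2 * relLam0 n - eps n * relLam0 n) /
    (n * (del n * (del n + 1)) - (4 - del n) * (3 - del n))

theorem relLam1_den_pos (hn : 4 ≤ n) :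
    0 < n * (del n * (del n + 1)) - (5 - del n) * (4 - del n) := by
  have h4 := cast_ge_four hn
  have h5 := eps_pos hn
  have h8 := sub_one_mul_eps hn
  have h7 := del_eq hn
  have : n * (del n * (del n + 1)) - (5 - del n) * (4 - del n)
      = eps n * (2 * n ^ 2 - 5 * n + 42) := by
    rw [h7]
    have : (n : ℝ) = 1 + 1 / eps n := by field_simp; linarith
    rw [this]
    field_simp
    ring
  rw [this]
  exact mul_pos h5 (by nlinarith)

theorem relLam1_eq (hn : 4 ≤ n) :
    (4 - del n) * (3 - del n) * relLam1 n + (2 - del n) / 2 * relLam0 n + eps n * relLam0 n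
      = del n * (del n + 1) * (n * (relLam1 n - relLam0 n / 12 + 1 / 160)
        + n * (n - 1) / 2 * (relLam0 n - 1 / 12) ^ 2) := by
  have h := relLam1_den_pos hn
  have h2 := del_le_two hn
  have h5 : n * (del n * (del n + 1)) - (4 - del n) * (3 - del n) ≠ 0 := by
    have : (4 - del n) * (3 - del n) ≤ (5 - del n) * (4 - del n) := by nlinarith
    have : 0 < n * (del n * (del n + 1)) - (4 - del n) * (3 - del n) := by linarith
    exact this.ne'
  have h6 : relLam1 n * (n * (del n * (del n + 1)) - (4 - del n) * (3 - del n)) =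
    -(del n * (del n + 1) * (n * (1 / 160 - relLam0 n / 12)
      + n * (n - 1) / 2 * (relLam0 n - 1 / 12) ^ 2)
      - (2 - del n) / 2 * relLam0 n - eps n * relLam0 n) := by
    rw [relLam1, div_mul_cancel₀ _ h5]
  linarith

/-- Up to a factor, the numerator of `λ₁` is an integer polynomial in `n`, without integer zeros
`n ≥ 4`; it does change sign, between `41` and `42`. -/
theorem relLam1_num_ne_zero (hn : 4 ≤ n) :
    (12672 - 20160 * n + 15472 * n ^ 2 - 6054 * n ^ 3 - 1785 * n ^ 4 - 1739 * n ^ 5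
      + 1302 * n ^ 6 + 300 * n ^ 7 - 8 * n ^ 8 : ℤ) ≠ 0 := by
  rcases le_or_gt 42 n with h | h
  · obtain ⟨m, rfl⟩ := Nat.exists_eq_add_of_le h
    have hm : (0 : ℤ) ≤ m := by positivity
    push_cast
    have : (12672 - 20160 * (42 + m) + 15472 * (42 + m) ^ 2 - 6054 * (42 + m) ^ 3
        - 1785 * (42 + m) ^ 4 - 1739 * (42 + m) ^ 5
        + 1302 * (42 + m) ^ 6 + 300 * (42 + m) ^ 7 - 8 * (42 + m) ^ 8 : ℤ) < 0 := by
      ring_nf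
      have := pow_nonneg hm 2
      have := pow_nonneg hm 3
      have := pow_nonneg hm 4
      have := pow_nonneg hm 5
      have := pow_nonneg hm 6
      have := pow_nonneg hm 7
      have := pow_nonneg hm 8
      linarith
    exact this.ne
  · interval_cases n <;> norm_num

theorem relLam0_closed (hn : 4 ≤ n) :
    relLam0 n = n * (2 * n ^ 2 - n + 8) / (12 * (n - 1) * (2 * n ^ 2 + 7 * n + 12)) := by
  have h4 := cast_ge_four hn
  have h5 : (n : ℝ) - 1 ≠ 0 := by linarith
  have h6 : (2 * n ^ 2 + 7 * n + 12 : ℝ) ≠ 0 := by positivity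
  have h := relLam0_eq hn
  have h7 : relLam0 n * (n * (del n * (del n + 1)) - (2 - del n) * (1 - del n))
      = n * (del n * (del n + 1)) / 12 - del n / 2 + eps n := by linarith
  have h8 : (n * (del n * (del n + 1)) - (2 - del n) * (1 - del n))
      = (2 * n ^ 2 + 7 * n + 12) / (n - 1) := by
    rw [del]; field_simp; ring
  have h9 : n * (del n * (del n + 1)) / 12 - del n / 2 + eps n
      = n * (2 * n ^ 2 - n + 8) / (12 * (n - 1) ^ 2) := by
    rw [del, eps]; field_simp; ring
  rw [h8, h9] at h7
  rw [eq_div_iff (by positivity)]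
  field_simp at h7
  linarith

theorem relLam1_num_identity {x y w d e p : ℝ} (hx : x = y + 1) (hy : y ≠ 0)
    (hw : w = 2 * x ^ 2 + 7 * x + 12) (hw0 : w ≠ 0) (hd : d = (x + 2) / y) (he : e = 1 / y)
    (hp : p = x * (2 * x ^ 2 - x + 8) / (12 * y * w)) :
    (d * (d + 1) * (x * (1 / 160 - p / 12) + x * (x - 1) / 2 * (p - 1 / 12) ^ 2)
        - (2 - d) / 2 * p - e * p) * (1440 * y ^ 4 * w ^ 2) =
      x * (12672 - 20160 * x + 15472 * x ^ 2 - 6054 * x ^ 3 - 1785 * x ^ 4 - 1739 * x ^ 5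
        + 1302 * x ^ 6 + 300 * x ^ 7 - 8 * x ^ 8) := by
  rw [hd, he, hp]
  field_simp
  subst hw
  subst hx
  ring

theorem relLam1_ne_zero (hn : 4 ≤ n) : relLam1 n ≠ 0 := by
  have h4 := cast_ge_four hn
  have h5 : (n : ℝ) - 1 ≠ 0 := by linarith
  have h6 : (2 * n ^ 2 + 7 * n + 12 : ℝ) ≠ 0 := by positivity
  have hZ := relLam1_num_ne_zero hn
  rw [← Int.cast_ne_zero (α := ℝ)] at hZ
  push_cast at hZ
  have h := relLam1_den_pos hn
  have h2 := del_le_two hn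
  have hd : n * (del n * (del n + 1)) - (4 - del n) * (3 - del n) ≠ 0 := by
    have : (4 - del n) * (3 - del n) ≤ (5 - del n) * (4 - del n) := by nlinarith
    have : 0 < n * (del n * (del n + 1)) - (4 - del n) * (3 - del n) := by linarith
    exact this.ne'
  refine div_ne_zero (neg_ne_zero.2 fun h0 => ?_) hd
  have := relLam1_num_identity (x := n) (y := n - 1) (d := del n) (e := eps n) (p := relLam0 n)
    (by ring) h5 rfl h6 rfl rfl (relLam0_closed hn)
  rw [h0, zero_mul] at this
  have hn0 : (n : ℝ) ≠ 0 := by linarith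
  exact mul_ne_zero hn0 hZ this.symm

end Parameters

/-! ### The error function -/

theorem hasDerivAt_mu1 (y : ℝ) : HasDerivAt mu1 (kap * Real.exp (-y ^ 2 / 4)) y := by
  have hc : Continuous fun σ : ℝ => Real.exp (-σ ^ 2) := by fun_prop
  have h := (hc.integral_hasStrictDerivAt 0 (y / 2)).hasDerivAt
  have h2 : HasDerivAt (fun y : ℝ => y / 2) (1 / 2) y := (hasDerivAt_id y).div_const 2
  have := (h.comp y h2).const_mul (2 / Real.sqrt Real.pi)
  convert! this using 1
  rw [kap, show -(y / 2) ^ 2 = -y ^ 2 / 4 by ring]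
  ring

theorem mu1_zero : mu1 0 = 0 := by simp [mu1]

theorem continuous_mu1 : Continuous mu1 :=
  continuous_iff_continuousAt.2 fun y => (hasDerivAt_mu1 y).continuousAt

theorem mu1_le {y : ℝ} (hy : 0 ≤ y) : mu1 y ≤ kap * y := by
  have hk := kap_pos
  have h : ∀ x, HasDerivAt (fun x => kap * x - mu1 x) (kap - kap * Real.exp (-x ^ 2 / 4)) x :=
    fun x => by
      convert! ((hasDerivAt_id x).const_mul kap).sub (hasDerivAt_mu1 x) using 1
      simp
  have hm : Monotone fun x => kap * x - mu1 x :=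
    monotone_of_hasDerivAt_nonneg h fun x => by
      have : Real.exp (-x ^ 2 / 4) ≤ 1 := Real.exp_le_one_iff.2 (by nlinarith [sq_nonneg x])
      simp only [Pi.zero_apply]
      nlinarith
  have := hm hy
  simp only [mu1_zero] at this
  linarith

theorem le_mu1 {y : ℝ} (hy : 0 ≤ y) : kap * y * Real.exp (-y ^ 2 / 4) ≤ mu1 y := by
  have hk := kap_pos
  have he : ∀ x : ℝ, HasDerivAt (fun x : ℝ => Real.exp (-x ^ 2 / 4))
      (-x / 2 * Real.exp (-x ^ 2 / 4)) x := fun x => by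
    convert! hasDerivAt_exp_sq (-1 / 4) x using 1
    · ext x; ring_nf
    · ring_nf
  have h : ∀ x, HasDerivAt (fun x => mu1 x - kap * x * Real.exp (-x ^ 2 / 4))
      (kap * (x ^ 2 / 2 * Real.exp (-x ^ 2 / 4))) x :=
    fun x => by
      convert! (hasDerivAt_mu1 x).sub (((hasDerivAt_id x).const_mul kap).mul (he x)) using 1
      simp; ring
  have hm : Monotone fun x => mu1 x - kap * x * Real.exp (-x ^ 2 / 4) :=
    monotone_of_hasDerivAt_nonneg h fun x => by
      simp only [Pi.zero_apply]
      positivity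
  have := hm hy
  simp only [mu1_zero] at this
  simp at this
  linarith

theorem mu1_pos {y : ℝ} (hy : 0 < y) : 0 < mu1 y :=
  lt_of_lt_of_le (by have := kap_pos; positivity) (le_mu1 hy.le)

/-- `μ₁(y) / (κ y) = 1 - y² / 12 + y⁴ / 160 + O(y⁶)`. -/
theorem mu1_taylor {y : ℝ} (hy : 0 < y) (hy2 : y ≤ 2) :
    |mu1 y / (kap * y) - (1 - y ^ 2 / 12 + y ^ 4 / 160)| ≤ y ^ 6 := by
  have hk := kap_pos
  have hd : ∀ x, HasDerivAt (fun x => mu1 x - kap * (x - x ^ 3 / 12 + x ^ 5 / 160))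
      (kap * (Real.exp (-x ^ 2 / 4) - (1 - x ^ 2 / 4 + x ^ 4 / 32))) x := fun x => by
    have h1 := (((hasDerivAt_id x).sub ((hasDerivAt_pow 3 x).div_const 12)).add
      ((hasDerivAt_pow 5 x).div_const 160)).const_mul kap
    convert! (hasDerivAt_mu1 x).sub h1 using 1
    simp; ring
  have hb : ∀ x ∈ Set.Icc 0 y,
      ‖kap * (Real.exp (-x ^ 2 / 4) - (1 - x ^ 2 / 4 + x ^ 4 / 32))‖ ≤ kap * y ^ 6 := by
    intro x hx
    have hx2 : x ^ 2 ≤ 4 := by nlinarith [hx.1, hx.2]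
    have h := Real.exp_bound (x := -x ^ 2 / 4) (n := 3)
      (by rw [abs_le]; constructor <;> nlinarith [sq_nonneg x]) (by norm_num)
    rw [norm_mul, Real.norm_of_nonneg hk.le, Real.norm_eq_abs]
    refine mul_le_mul_of_nonneg_left ?_ hk.le
    simp only [Finset.sum_range_succ, Finset.sum_range_zero] at h
    norm_num [Nat.factorial] at h
    have h6 : x ^ 6 ≤ y ^ 6 := pow_le_pow_left₀ hx.1 hx.2 6
    have h7 : |x ^ 2| ^ 3 = x ^ 6 := by rw [abs_of_nonneg (sq_nonneg x)]; ring
    calc |Real.exp (-x ^ 2 / 4) - (1 - x ^ 2 / 4 + x ^ 4 / 32)|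
        = |Real.exp (-x ^ 2 / 4) - (1 + -x ^ 2 / 4 + (-x ^ 2 / 4) ^ 2 / 2)| := by
          congr 1; ring
      _ ≤ _ := h
      _ ≤ y ^ 6 := by
        rw [abs_div, abs_neg, div_pow, h7]
        norm_num
        have : 0 ≤ x ^ 6 := by positivity
        linarith
  have h := Convex.norm_image_sub_le_of_norm_hasDerivWithin_le
    (fun x _ => (hd x).hasDerivWithinAt) hb (convex_Icc 0 y)
    (Set.left_mem_Icc.2 hy.le) (Set.right_mem_Icc.2 hy.le)
  simp only [mu1_zero, sub_zero, Real.norm_eq_abs, abs_of_pos hy] at h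
  norm_num at h
  have h8 : mu1 y / (kap * y) - (1 - y ^ 2 / 12 + y ^ 4 / 160)
      = (mu1 y - kap * (y - y ^ 3 / 12 + y ^ 5 / 160)) / (kap * y) := by
    field_simp
  rw [h8, abs_div, abs_of_pos (mul_pos hk hy), div_le_iff₀ (mul_pos hk hy)]
  linarith

/-! ### A two-point boundary value problem -/

/-- Truncation of `x` to the interval `[-R, R]`. -/
def trunc (R x : ℝ) : ℝ := max (-R) (min R x)

theorem trunc_eq {R x : ℝ} (h : |x| ≤ R) : trunc R x = x := by
  rw [abs_le] at h
  rw [trunc, min_eq_right h.2, max_eq_right h.1]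

theorem abs_trunc_le {R : ℝ} (hR : 0 ≤ R) (x : ℝ) : |trunc R x| ≤ R := by
  rw [abs_le, trunc]
  exact ⟨le_max_left _ _, max_le (by linarith) (min_le_left _ _)⟩

theorem abs_trunc_sub_le (R x y : ℝ) : |trunc R x - trunc R y| ≤ |x - y| := by
  calc |max (-R) (min R x) - max (-R) (min R y)| ≤ |min R x - min R y| :=
        abs_max_sub_max_le_max (-R) _ (-R) _ |>.trans (by simp)
    _ ≤ |x - y| := abs_min_sub_min_le_max R x R y |>.trans (by simp)

/-- Shooting: the boundary value problem `(u' / r)' = F(t, u)`, `u(α) = A`, `u(β) = B` is solvable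
when `F` is bounded, nonnegative and Lipschitz in `u`. -/
theorem exists_boundary_value {α β A B N R₀ : ℝ} {K : NNReal} {r : ℝ → ℝ} {F : ℝ → ℝ → ℝ}
    (hαβ : α < β) (hr : ContinuousOn r (Set.Icc α β))
    (hr1 : ∀ t ∈ Set.Icc α β, 1 ≤ r t) (hr2 : ∀ t ∈ Set.Icc α β, r t ≤ R₀)
    (hFc : ∀ x, ContinuousOn (fun t => F t x) (Set.Icc α β))
    (hFL : ∀ t ∈ Set.Icc α β, LipschitzWith K (F t))
    (hF0 : ∀ t ∈ Set.Icc α β, ∀ x, 0 ≤ F t x) (hFN : ∀ t ∈ Set.Icc α β, ∀ x, F t x ≤ N) :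
    ∃ u w : ℝ → ℝ, u α = A ∧ u β = B ∧ ∀ t ∈ Set.Icc α β,
      HasDerivWithinAt u (r t * w t) (Set.Icc α β) t ∧
      HasDerivWithinAt w (F t (u t)) (Set.Icc α β) t := by
  have hαm : α ∈ Set.Icc α β := ⟨le_rfl, hαβ.le⟩
  have hβm : β ∈ Set.Icc α β := ⟨hαβ.le, le_rfl⟩
  have hR0 : 1 ≤ R₀ := (hr1 α hαm).trans (hr2 α hαm)
  have hN : 0 ≤ N := (hF0 α hαm 0).trans (hFN α hαm 0)
  have hl : 0 < β - α := sub_pos.2 hαβ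
  -- Slopes beyond `± m` overshoot the target value `B`.
  set m : ℝ := |B - A| / (β - α) + N * (β - α) with hm
  have hm0 : 0 ≤ m := by positivity
  set R : ℝ := m + N * (β - α) with hR
  have hRm : 0 ≤ R := by positivity
  -- The truncated system is bounded, so that Picard-Lindelöf yields its flow on all of `[α, β]`.
  set V : ℝ → ℝ × ℝ → ℝ × ℝ := fun t x => (r t * trunc R x.2, F t x.1) with hV
  set Λ : ℝ := R₀ * R + N with hΛ
  have hΛ0 : 0 ≤ Λ := by positivity
  set a : ℝ := m + Λ * (β - α) with ha
  have ha0 : 0 ≤ a := by positivity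
  have hmN := Real.coe_toNNReal m hm0
  have haN := Real.coe_toNNReal a ha0
  have hΛN := Real.coe_toNNReal Λ hΛ0
  have hRN := Real.coe_toNNReal R₀ (by linarith)
  have hPL : IsPicardLindelof V (⟨α, hαm⟩ : Set.Icc α β) ((A, 0) : ℝ × ℝ)
      a.toNNReal m.toNNReal Λ.toNNReal (R₀.toNNReal + K) := by
    refine ⟨fun t ht => ?_, fun x _ => ?_, fun t ht x _ => ?_, ?_⟩
    · refine (LipschitzWith.of_dist_le_mul fun x y => ?_).lipschitzOnWith
      rw [Prod.dist_eq]
      have h0 : 0 ≤ dist x y := dist_nonneg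
      have hx1 : dist x.1 y.1 ≤ dist x y := by rw [Prod.dist_eq]; exact le_max_left _ _
      have hx2 : dist x.2 y.2 ≤ dist x y := by rw [Prod.dist_eq]; exact le_max_right _ _
      refine max_le ?_ ?_
      · simp only [hV]
        rw [Real.dist_eq, ← mul_sub, abs_mul, abs_of_nonneg (by linarith [hr1 t ht])]
        have h1 := abs_trunc_sub_le R x.2 y.2
        rw [← Real.dist_eq x.2] at h1
        calc r t * |trunc R x.2 - trunc R y.2| ≤ R₀ * dist x y :=
              mul_le_mul (hr2 t ht) (h1.trans hx2) (abs_nonneg _) (by linarith)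
          _ ≤ _ := by
              rw [NNReal.coe_add, hRN]
              have : 0 ≤ (K : ℝ) * dist x y := by positivity
              linarith
      · simp only [hV]
        have h1 := (hFL t ht).dist_le_mul x.1 y.1
        have h2 : (K : ℝ) * dist x.1 y.1 ≤ K * dist x y :=
          mul_le_mul_of_nonneg_left hx1 K.2
        have : 0 ≤ R₀ * dist x y := by positivity
        rw [NNReal.coe_add, hRN]
        linarith
    · exact (hr.mul continuousOn_const).prodMk (hFc x.1)
    · simp only [hV, Prod.norm_def, hΛN]
      have h1 : 0 ≤ R₀ * R := by positivity
      refine max_le ?_ ?_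
      · rw [norm_mul, Real.norm_eq_abs, Real.norm_eq_abs, abs_of_nonneg (by linarith [hr1 t ht])]
        have := mul_le_mul (hr2 t ht) (abs_trunc_le hRm x.2) (abs_nonneg _) (by linarith)
        linarith
      · rw [Real.norm_eq_abs, abs_of_nonneg (hF0 t ht _)]
        linarith [hFN t ht x.1]
    · simp only [hmN, haN, hΛN, sub_self, max_eq_left hl.le]
      linarith [ha]
  obtain ⟨Φ, hΦ, hΦc⟩ := hPL.exists_forall_mem_closedBall_eq_hasDerivWithinAt_continuousOn
  rw [hmN] at hΦ hΦc
  have hball : ∀ s ∈ Set.Icc (-m) m, ((A, s) : ℝ × ℝ) ∈ Metric.closedBall ((A, 0) : ℝ × ℝ) m := by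
    intro s hs
    rw [Metric.mem_closedBall, Prod.dist_eq]
    simp only [dist_self, Real.dist_eq, sub_zero]
    exact max_le hm0 (abs_le.2 hs)
  have hu : ∀ s ∈ Set.Icc (-m) m, ∀ t ∈ Set.Icc α β, HasDerivWithinAt
      (fun t => (Φ ((A, s), t)).1) (r t * trunc R (Φ ((A, s), t)).2) (Set.Icc α β) t :=
    fun s hs t ht => ((hΦ _ (hball s hs)).2 t ht).fst
  have hw : ∀ s ∈ Set.Icc (-m) m, ∀ t ∈ Set.Icc α β, HasDerivWithinAt
      (fun t => (Φ ((A, s), t)).2) (F t (Φ ((A, s), t)).1) (Set.Icc α β) t :=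
    fun s hs t ht => ((hΦ _ (hball s hs)).2 t ht).snd
  -- A mean value inequality for functions on `[α, β]`.
  have hmv : ∀ {f f' : ℝ → ℝ} {c C : ℝ},
      (∀ t ∈ Set.Icc α β, HasDerivWithinAt f (f' t) (Set.Icc α β) t) →
      (∀ t ∈ Set.Icc α β, c ≤ f' t ∧ f' t ≤ C) → ∀ t ∈ Set.Icc α β,
      f α + c * (t - α) ≤ f t ∧ f t ≤ f α + C * (t - α) := by
    intro f f' c C hf hb t ht
    have hcont : ContinuousOn f (Set.Icc α β) := fun x hx => (hf x hx).continuousWithinAt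
    have hdiff : ∀ x ∈ Set.Ioo α β, HasDerivAt f (f' x) x := fun x hx =>
      (hf x (Set.Ioo_subset_Icc_self hx)).hasDerivAt (Icc_mem_nhds hx.1 hx.2)
    rcases eq_or_lt_of_le ht.1 with rfl | hlt
    · simp
    obtain ⟨x, hx, hx'⟩ := exists_hasDerivAt_eq_slope f f' hlt
      (hcont.mono (Set.Icc_subset_Icc le_rfl ht.2)) fun x hx => hdiff x ⟨hx.1, hx.2.trans_le ht.2⟩
    have h3 := hb x ⟨hx.1.le, hx.2.le.trans ht.2⟩
    have h4 : f t - f α = f' x * (t - α) := by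
      rw [hx']
      have : t - α ≠ 0 := by linarith
      field_simp
    have h5 : 0 < t - α := by linarith
    constructor <;> nlinarith [h3.1, h3.2]
  have hinit : ∀ s ∈ Set.Icc (-m) m, Φ ((A, s), α) = (A, s) := fun s hs => (hΦ _ (hball s hs)).1
  have hwb : ∀ s ∈ Set.Icc (-m) m, ∀ t ∈ Set.Icc α β,
      s ≤ (Φ ((A, s), t)).2 ∧ (Φ ((A, s), t)).2 ≤ s + N * (β - α) := by
    intro s hs t ht
    have h := hmv (hw s hs) (c := 0) (C := N)
      (fun t ht => ⟨hF0 t ht _, hFN t ht _⟩) t ht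
    simp only [hinit s hs] at h
    have : N * (t - α) ≤ N * (β - α) := mul_le_mul_of_nonneg_left (by linarith [ht.2]) hN
    constructor <;> linarith [h.1, h.2]
  have htr : ∀ s ∈ Set.Icc (-m) m, ∀ t ∈ Set.Icc α β,
      trunc R (Φ ((A, s), t)).2 = (Φ ((A, s), t)).2 := by
    intro s hs t ht
    have h := hwb s hs t ht
    have : 0 ≤ N * (β - α) := by positivity
    exact trunc_eq (abs_le.2 ⟨by linarith [hs.1, h.1], by linarith [hs.2, h.2]⟩)
  have hu' : ∀ s ∈ Set.Icc (-m) m, ∀ t ∈ Set.Icc α β, HasDerivWithinAt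
      (fun t => (Φ ((A, s), t)).1) (r t * (Φ ((A, s), t)).2) (Set.Icc α β) t := fun s hs t ht => by
    have := hu s hs t ht
    rwa [htr s hs t ht] at this
  have hmm : -m ∈ Set.Icc (-m) m := ⟨le_rfl, by linarith⟩
  have hmp : m ∈ Set.Icc (-m) m := ⟨by linarith, le_rfl⟩
  have hBA : |B - A| / (β - α) * (β - α) = |B - A| := div_mul_cancel₀ _ hl.ne'
  have hNl : 0 ≤ N * (β - α) := by positivity
  have hq : 0 ≤ |B - A| / (β - α) := by positivity
  have hlow : (Φ ((A, -m), β)).1 ≤ B := by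
    have h := (hmv (hu' (-m) hmm) (c := -(R₀ * R)) (C := -(|B - A| / (β - α))) (fun t ht => by
      have h := hwb (-m) hmm t ht
      have h1 := hr1 t ht
      have h2 := hr2 t ht
      have h3 : (Φ ((A, -m), t)).2 ≤ -(|B - A| / (β - α)) := by linarith [h.2]
      constructor
      · have : r t * R ≤ R₀ * R := mul_le_mul_of_nonneg_right h2 hRm
        have : r t * -R ≤ r t * (Φ ((A, -m), t)).2 :=
          mul_le_mul_of_nonneg_left (by linarith [h.1]) (by linarith)
        linarith
      · nlinarith) β hβm).2
    simp only [hinit _ hmm] at h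
    have := neg_abs_le (B - A)
    linarith
  have hhigh : B ≤ (Φ ((A, m), β)).1 := by
    have h := (hmv (hu' m hmp) (c := |B - A| / (β - α)) (C := R₀ * R) (fun t ht => by
      have h := hwb m hmp t ht
      have h1 := hr1 t ht
      have h2 := hr2 t ht
      have h3 : |B - A| / (β - α) ≤ (Φ ((A, m), t)).2 := by linarith [h.1]
      constructor
      · nlinarith
      · exact mul_le_mul h2 (by linarith [h.2]) (by linarith) (by linarith)) β hβm).1
    simp only [hinit _ hmp] at h
    have := le_abs_self (B - A)
    linarith
  have hcont : ContinuousOn (fun s => (Φ ((A, s), β)).1) (Set.Icc (-m) m) := by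
    refine continuous_fst.comp_continuousOn (hΦc.comp (by fun_prop) fun s hs => ?_)
    exact ⟨hball s hs, hβm⟩
  obtain ⟨s, hs, hsB⟩ := intermediate_value_Icc (by linarith : -m ≤ m) hcont ⟨hlow, hhigh⟩
  exact ⟨fun t => (Φ ((A, s), t)).1, fun t => (Φ ((A, s), t)).2, by simp [hinit s hs], hsB,
    fun t ht => ⟨hu' s hs t ht, hw s hs t ht⟩⟩

/-! ### Pointwise limits of solutions -/

section Limit

open MeasureTheory intervalIntegral

/-- A pointwise limit `u` on `(0, ∞)` of locally bounded solutions `U k` of `(u' / r)' = Φ(y, u)`,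
the `k`-th being defined on an interval that exhausts `(0, ∞)`, is again a solution. No uniformity
is assumed: the convergence of the derivatives follows from dominated convergence in the integrated
equation. -/
theorem hasDerivAt_of_tendsto_solutions {r : ℝ → ℝ} {Φ : ℝ → ℝ → ℝ} {U W : ℕ → ℝ → ℝ} {u : ℝ → ℝ}
    (hr : Continuous r) (hr0 : ∀ y, 0 < r y) (hΦ : Continuous (Function.uncurry Φ))
    (hder : ∀ c d, 0 < c → c < d → ∀ᶠ k in atTop, ∀ y ∈ Set.Icc c d,
      HasDerivAt (U k) (r y * W k y) y ∧ HasDerivAt (W k) (Φ y (U k y)) y)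
    (hbdd : ∀ c d, 0 < c → c < d → ∃ C, ∀ᶠ k in atTop, ∀ y ∈ Set.Icc c d, |Φ y (U k y)| ≤ C)
    (hlim : ∀ y, 0 < y → Tendsto (fun k => U k y) atTop (𝓝 (u y))) :
    ∃ w : ℝ → ℝ, ∀ y, 0 < y → HasDerivAt u (r y * w y) y ∧ HasDerivAt w (Φ y (u y)) y := by
  set f : ℕ → ℝ → ℝ := fun k τ => Φ τ (U k τ) with hf
  set F : ℝ → ℝ := fun τ => Φ τ (u τ) with hF
  have hcont1 : ∀ {c d : ℝ} {k : ℕ}, (∀ y ∈ Set.Icc c d,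
      HasDerivAt (U k) (r y * W k y) y ∧ HasDerivAt (W k) (Φ y (U k y)) y) →
      ContinuousOn (f k) (Set.Icc c d) := fun h => hΦ.comp_continuousOn
        (continuousOn_id.prodMk fun y hy => (h y hy).1.continuousAt.continuousWithinAt)
  have hflim : ∀ y, 0 < y → Tendsto (fun k => f k y) atTop (𝓝 (F y)) := fun y hy =>
    (hΦ.tendsto (y, u y)).comp (tendsto_const_nhds.prodMk_nhds (hlim y hy))
  have hsub : ∀ {c d x y : ℝ}, x ∈ Set.Icc c d → y ∈ Set.Icc c d → Set.uIcc x y ⊆ Set.Icc c d :=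
    fun hx hy => Set.uIcc_subset_Icc hx hy
  -- Convergence of the inner integrals.
  have hJ : ∀ c d, 0 < c → c < d → ∀ x ∈ Set.Icc c d, ∀ y ∈ Set.Icc c d,
      Tendsto (fun k => ∫ τ in x..y, f k τ) atTop (𝓝 (∫ τ in x..y, F τ)) := by
    intro c d hc hcd x hx y hy
    obtain ⟨C, hC⟩ := hbdd c d hc hcd
    refine tendsto_integral_filter_of_dominated_convergence (fun _ => C) ?_ ?_
      intervalIntegrable_const ?_
    · filter_upwards [hder c d hc hcd] with k hk
      exact ((hcont1 hk).mono (Set.uIoc_subset_uIcc.trans (hsub hx hy))).aestronglyMeasurable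
        measurableSet_uIoc
    · filter_upwards [hC] with k hk
      exact Eventually.of_forall fun τ hτ => hk τ (hsub hx hy (Set.uIoc_subset_uIcc hτ))
    · exact Eventually.of_forall fun τ hτ =>
        hflim τ (hc.trans_le (hsub hx hy (Set.uIoc_subset_uIcc hτ)).1)
  have hFint : ∀ c d, 0 < c → c < d → IntervalIntegrable F volume c d := by
    intro c d hc hcd
    obtain ⟨C, hC⟩ := hbdd c d hc hcd
    have hmem : ∀ τ ∈ Set.uIoc c d, τ ∈ Set.Icc c d := fun τ hτ =>
      hsub (Set.left_mem_Icc.2 hcd.le) (Set.right_mem_Icc.2 hcd.le) (Set.uIoc_subset_uIcc hτ)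
    obtain ⟨k₀, hk₀⟩ := eventually_atTop.1 (hder c d hc hcd)
    have hmeas : AEStronglyMeasurable F (volume.restrict (Set.uIoc c d)) := by
      refine aestronglyMeasurable_of_tendsto_ae (u := atTop) (f := fun k => f (k + k₀))
        (fun k => ?_) ?_
      · exact ((hcont1 (hk₀ _ (by omega))).mono hmem).aestronglyMeasurable measurableSet_uIoc
      · refine (ae_restrict_iff' measurableSet_uIoc).2 (Eventually.of_forall fun τ hτ => ?_)
        exact (hflim τ (hc.trans_le (hmem τ hτ).1)).comp (tendsto_add_atTop_nat k₀)
    refine (intervalIntegrable_const (c := C)).mono_fun hmeas ?_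
    refine (ae_restrict_iff' measurableSet_uIoc).2 (Eventually.of_forall fun τ hτ => ?_)
    have h1 := (hflim τ (hc.trans_le (hmem τ hτ).1)).abs
    have h2 : |F τ| ≤ C := le_of_tendsto h1 (by
      filter_upwards [hC] with k hk using hk τ (hmem τ hτ))
    exact h2.trans (le_abs_self C)
  -- The integrated equations.
  have hW : ∀ c d, 0 < c → c < d → ∀ x ∈ Set.Icc c d, ∀ᶠ k in atTop, ∀ y ∈ Set.Icc c d,
      W k y = W k x + ∫ τ in x..y, f k τ := by
    intro c d hc hcd x hx
    filter_upwards [hder c d hc hcd] with k hk y hy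
    rw [integral_eq_sub_of_hasDerivAt (fun t ht => (hk t (hsub hx hy ht)).2)
      (((hcont1 hk).mono (hsub hx hy)).intervalIntegrable)]
    ring
  have hU : ∀ c d, 0 < c → c < d → ∀ x ∈ Set.Icc c d, ∀ᶠ k in atTop, ∀ y ∈ Set.Icc c d,
      U k y - U k x = ∫ τ in x..y, r τ * W k τ := by
    intro c d hc hcd x hx
    filter_upwards [hder c d hc hcd] with k hk y hy
    rw [integral_eq_sub_of_hasDerivAt (fun t ht => (hk t (hsub hx hy ht)).1)]
    exact ((hr.continuousOn.mul fun t ht =>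
      (hk t (hsub hx hy ht)).2.continuousAt.continuousWithinAt)).intervalIntegrable
  -- Convergence of `∫ r W` once the values of `W` converge.
  have hdom : ∀ c d, 0 < c → c < d → ∀ x ∈ Set.Icc c d, ∀ y ∈ Set.Icc c d,
      Tendsto (fun k => ∫ τ in x..y, r τ * ∫ σ in x..τ, f k σ) atTop
        (𝓝 (∫ τ in x..y, r τ * ∫ σ in x..τ, F σ)) := by
    intro c d hc hcd x hx y hy
    obtain ⟨C, hC⟩ := hbdd c d hc hcd
    refine tendsto_integral_filter_of_dominated_convergence (fun τ => r τ * (C * (d - c))) ?_ ?_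
      ((hr.mul continuous_const).intervalIntegrable _ _) ?_
    · filter_upwards [hder c d hc hcd] with k hk
      refine ((hr.continuousOn.mul ?_).mono
        Set.uIoc_subset_uIcc).aestronglyMeasurable measurableSet_uIoc
      exact continuousOn_primitive_interval' ((hcont1 hk).mono (hsub hx hy)).intervalIntegrable
        Set.left_mem_uIcc
    · filter_upwards [hC] with k hk
      refine Eventually.of_forall fun τ hτ => ?_
      have hτ' := hsub hx hy (Set.uIoc_subset_uIcc hτ)
      have hC0 : 0 ≤ C := (abs_nonneg _).trans (hk x hx)
      rw [norm_mul, Real.norm_of_nonneg (hr0 τ).le]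
      refine mul_le_mul_of_nonneg_left ?_ (hr0 τ).le
      have h1 := norm_integral_le_of_norm_le_const (a := x) (b := τ) (f := f k) (C := C)
        fun σ hσ => hk σ (hsub hx hτ' (Set.uIoc_subset_uIcc hσ))
      refine h1.trans (mul_le_mul_of_nonneg_left ?_ hC0)
      rw [abs_le]
      constructor <;> linarith [hτ'.1, hτ'.2, hx.1, hx.2]
    · refine Eventually.of_forall fun τ hτ => ?_
      exact (hJ c d hc hcd x hx τ (hsub hx hy (Set.uIoc_subset_uIcc hτ))).const_mul _
  have hsplit : ∀ c d, 0 < c → c < d → ∀ x ∈ Set.Icc c d, ∀ᶠ k in atTop, ∀ y ∈ Set.Icc c d,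
      U k y - U k x = W k x * (∫ τ in x..y, r τ) + ∫ τ in x..y, r τ * ∫ σ in x..τ, f k σ := by
    intro c d hc hcd x hx
    filter_upwards [hder c d hc hcd, hW c d hc hcd x hx, hU c d hc hcd x hx] with k hk h1 h2 y hy
    rw [h2 y hy, ← intervalIntegral.integral_const_mul, ← intervalIntegral.integral_add]
    · refine integral_congr fun τ hτ => ?_
      rw [h1 τ (hsub hx hy hτ)]
      ring
    · exact (continuous_const.mul hr).intervalIntegrable _ _
    · exact (hr.continuousOn.mul (continuousOn_primitive_interval'
        ((hcont1 hk).mono (hsub hx hy)).intervalIntegrable Set.left_mem_uIcc)).intervalIntegrable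
  -- The slopes at `1` converge, as is seen from the values at `1` and `2`.
  have hrI : 0 < ∫ τ in (1 : ℝ)..2, r τ :=
    intervalIntegral_pos_of_pos (hr.intervalIntegrable _ _) hr0 (by norm_num)
  obtain ⟨m, hm⟩ : ∃ m, Tendsto (fun k => W k 1) atTop (𝓝 m) := by
    have h1 := ((hlim 2 (by norm_num)).sub (hlim 1 (by norm_num))).sub
      (hdom 1 2 (by norm_num) (by norm_num) 1 (by norm_num) 2 (by norm_num))
    refine ⟨_, (h1.div_const (∫ τ in (1 : ℝ)..2, r τ)).congr' ?_⟩
    filter_upwards [hsplit 1 2 (by norm_num) (by norm_num) 1 (by norm_num)] with k hk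
    rw [hk 2 (by norm_num)]
    field_simp
    ring
  set w : ℝ → ℝ := fun y => m + ∫ τ in (1 : ℝ)..y, F τ with hw
  have hcd : ∀ y : ℝ, 0 < y →
      ∃ c d : ℝ, 0 < c ∧ c < d ∧ y ∈ Set.Ioo c d ∧ (1 : ℝ) ∈ Set.Ioo c d := by
    intro y hy
    refine ⟨min y 1 / 2, max y 1 + 1, by positivity, ?_, ⟨?_, ?_⟩, ?_, ?_⟩
    all_goals
      rcases le_total y 1 with h | h <;> simp only [h, min_eq_left, min_eq_right, max_eq_left,
        max_eq_right] <;> linarith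
  have hwc : ∀ c d, 0 < c → c < d → (1 : ℝ) ∈ Set.Ioo c d → ContinuousOn w (Set.Icc c d) := by
    intro c d hc hcd h1
    refine continuousOn_const.add ?_
    have h1' := Set.Ioo_subset_Icc_self h1
    rw [← Set.uIcc_of_le hcd.le] at h1' ⊢
    exact continuousOn_primitive_interval' (hFint c d hc hcd) h1'
  have hu : ∀ y, 0 < y → u y = u 1 + ∫ τ in (1 : ℝ)..y, r τ * w τ := by
    intro y hy
    obtain ⟨c, d, hc, hcd, hyI, h1I⟩ := hcd y hy
    have hy' := Set.Ioo_subset_Icc_self hyI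
    have h1' := Set.Ioo_subset_Icc_self h1I
    have h1 := (hlim y hy).sub (hlim 1 one_pos)
    have h2 := (hm.mul_const (∫ τ in (1 : ℝ)..y, r τ)).add (hdom c d hc hcd 1 h1' y hy')
    have h3 := tendsto_nhds_unique (h1.congr' (by
      filter_upwards [hsplit c d hc hcd 1 h1'] with k hk using hk y hy')) h2
    have h4 : ∫ τ in (1 : ℝ)..y, r τ * w τ = m * (∫ τ in (1 : ℝ)..y, r τ) +
        ∫ τ in (1 : ℝ)..y, r τ * ∫ σ in (1 : ℝ)..τ, F σ := by
      rw [← intervalIntegral.integral_const_mul, ← intervalIntegral.integral_add]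
      · refine integral_congr fun τ _ => ?_
        simp only [hw]
        ring
      · exact (continuous_const.mul hr).intervalIntegrable _ _
      · refine (hr.continuousOn.mul ?_).intervalIntegrable
        refine (((hwc c d hc hcd h1I).sub (continuousOn_const (c := m))).mono
          (hsub h1' hy')).congr fun τ _ => ?_
        simp [hw]
    rw [h4]
    linarith
  have hu1 : ∀ y, 0 < y → HasDerivAt u (r y * w y) y := by
    intro y hy
    obtain ⟨c, d, hc, hcd, hyI, h1I⟩ := hcd y hy
    have hnhds : Set.Icc c d ∈ 𝓝 y := Icc_mem_nhds hyI.1 hyI.2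
    have hcont : ContinuousOn (fun τ => r τ * w τ) (Set.Icc c d) :=
      hr.continuousOn.mul (hwc c d hc hcd h1I)
    have h := integral_hasDerivAt_right
      ((hcont.mono (hsub (Set.Ioo_subset_Icc_self h1I) (Set.Ioo_subset_Icc_self hyI)))
        |>.intervalIntegrable)
      (AEStronglyMeasurable.stronglyMeasurableAtFilter_of_mem
        (hcont.aestronglyMeasurable measurableSet_Icc) hnhds) (hcont.continuousAt hnhds)
    refine (h.const_add (u 1)).congr_of_eventuallyEq ?_
    filter_upwards [Ioi_mem_nhds hy] with z hz using hu z hz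
  refine ⟨w, fun y hy => ⟨hu1 y hy, ?_⟩⟩
  obtain ⟨c, d, hc, hcd, hyI, h1I⟩ := hcd y hy
  have hnhds : Set.Icc c d ∈ 𝓝 y := Icc_mem_nhds hyI.1 hyI.2
  have hcont : ContinuousOn F (Set.Icc c d) := hΦ.comp_continuousOn
    (continuousOn_id.prodMk fun z hz =>
      (hu1 z (hc.trans_le hz.1)).continuousAt.continuousWithinAt)
  exact (integral_hasDerivAt_right
      ((hcont.mono (hsub (Set.Ioo_subset_Icc_self h1I) (Set.Ioo_subset_Icc_self hyI)))
        |>.intervalIntegrable)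
      (AEStronglyMeasurable.stronglyMeasurableAtFilter_of_mem
        (hcont.aestronglyMeasurable measurableSet_Icc) hnhds)
      (hcont.continuousAt hnhds)).const_add m

end Limit

/-! ### The equation for `exp (y² / 4) μ`, and its barriers -/

section Barriers

variable {n : ℕ}

/-- The coefficient `1 / 2 - ε` of the linear term in the equation for `u = exp (y² / 4) μ`; it is
positive, unlike the one (after a change of sides) in the equation for `μ`. -/
def rate (n : ℕ) : ℝ := 1 / 2 - eps n

/-- The coefficient of `u ^ n` in the equation for `u = exp (y² / 4) μ`. -/
def coef (n : ℕ) (y : ℝ) : ℝ := Real.exp (y ^ 2 / 4) * (2 * mu1 y * Real.exp (-(y ^ 2 / 4))) ^ n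

/-- The right-hand side of the equation `u'' - (y / 2) u' = (1 / 2 - ε) u + coef(y) u ^ n` for
`u = exp (y² / 4) μ`. -/
def force (n : ℕ) (y x : ℝ) : ℝ := rate n * x + coef n y * x ^ n

theorem rate_pos (hn : 4 ≤ n) : 0 < rate n := by
  have := eps_le hn
  rw [rate]; linarith

theorem coef_pos {y : ℝ} (hy : 0 < y) : 0 < coef n y := by
  have := mu1_pos hy
  rw [coef]; positivity

theorem continuous_coef : Continuous (coef n) := by
  have := continuous_mu1
  unfold coef
  fun_prop

theorem continuous_force : Continuous (Function.uncurry (force n)) := by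
  have := continuous_coef (n := n)
  unfold force Function.uncurry
  fun_prop

theorem force_mono (hn : 4 ≤ n) {y x z : ℝ} (hy : 0 < y) (hx : 0 ≤ x) (hxz : x ≤ z) :
    force n y x ≤ force n y z := by
  have h1 := mul_le_mul_of_nonneg_left hxz (rate_pos hn).le
  have h2 := mul_le_mul_of_nonneg_left (pow_le_pow_left₀ hx hxz n) (coef_pos (n := n) hy).le
  exact add_le_add h1 h2

theorem force_strictMono (hn : 4 ≤ n) {y x z : ℝ} (hy : 0 < y) (hx : 0 ≤ x) (hxz : x < z) :
    force n y x < force n y z := by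
  have h1 := mul_lt_mul_of_pos_left hxz (rate_pos hn)
  have h2 := mul_le_mul_of_nonneg_left (pow_le_pow_left₀ hx hxz.le n) (coef_pos (n := n) hy).le
  exact add_lt_add_of_lt_of_le h1 h2

theorem force_nonneg (hn : 4 ≤ n) {y x : ℝ} (hy : 0 < y) (hx : 0 ≤ x) : 0 ≤ force n y x := by
  have := rate_pos hn
  have := coef_pos (n := n) hy
  rw [force]; positivity

theorem hasDerivAt_const_mul_rpow (c s : ℝ) {y : ℝ} (hy : 0 < y) :
    HasDerivAt (fun x : ℝ => c * x ^ s) (c * s * y ^ s / y) y := by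
  convert! (Real.hasDerivAt_rpow_const (p := s) (Or.inl hy.ne')).const_mul c using 1
  rw [Real.rpow_sub_one hy.ne']
  ring

theorem hasDerivAt_const_mul_rpow_div (c s : ℝ) {y : ℝ} (hy : 0 < y) :
    HasDerivAt (fun x : ℝ => c * x ^ s / x) (c * (s - 1) * y ^ s / y ^ 2) y := by
  have h := (hasDerivAt_const_mul_rpow c s hy).div (hasDerivAt_id y) hy.ne'
  convert! h using 1
  simp
  field_simp

/-- `(y y ^ (-δ)) ^ n = y ^ (-δ - 2)`. -/
theorem mul_rpow_neg_del_pow (hn : 4 ≤ n) {y : ℝ} (hy : 0 < y) :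
    (y * y ^ (-del n)) ^ n = y ^ (-del n) / y ^ 2 := by
  have h := cast_mul_del hn
  have h1 : y * y ^ (-del n) = y ^ (1 - del n) := by
    rw [sub_eq_add_neg, Real.rpow_add hy, Real.rpow_one]
  rw [h1, ← Real.rpow_natCast, ← Real.rpow_mul hy.le, ← Real.rpow_natCast y 2, ← Real.rpow_sub hy]
  congr 1
  push_cast
  linarith

/-- `λ y ^ (-δ)` is a subsolution. -/
theorem force_lower_barrier (hn : 4 ≤ n) {y : ℝ} (hy : 0 < y) :
    force n y (lam n * y ^ (-del n)) ≤
      lam n * (del n * (del n + 1)) * y ^ (-del n) / y ^ 2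
        + lam n * (del n / 2) * y ^ (-del n) := by
  have hl := lam_pos hn
  have hX : 0 < y ^ (-del n) := Real.rpow_pos_of_pos hy _
  have hk := kap_pos
  have hm := mu1_pos hy
  have h1 : coef n y * (lam n * y ^ (-del n)) ^ n ≤
      lam n * (del n * (del n + 1)) * y ^ (-del n) / y ^ 2 := by
    have he : Real.exp (y ^ 2 / 4) * Real.exp (-(y ^ 2 / 4)) ^ n ≤ 1 := by
      rw [← Real.exp_nat_mul, ← Real.exp_add, Real.exp_le_one_iff]
      have := cast_ge_four hn
      nlinarith [sq_nonneg y]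
    calc coef n y * (lam n * y ^ (-del n)) ^ n
        = (Real.exp (y ^ 2 / 4) * Real.exp (-(y ^ 2 / 4)) ^ n) *
          (2 * mu1 y * (lam n * y ^ (-del n))) ^ n := by
          rw [coef, mul_pow _ (Real.exp _), mul_pow (2 * mu1 y) (lam n * _)]; ring
      _ ≤ 1 * (2 * (kap * y) * (lam n * y ^ (-del n))) ^ n := by
          have := mu1_le hy.le
          gcongr
      _ = (2 * kap) ^ n * lam n ^ n * (y * y ^ (-del n)) ^ n := by
          rw [← mul_pow, ← mul_pow, one_mul]; congr 1; ring
      _ = _ := by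
          rw [lam_pow' hn, mul_rpow_neg_del_pow hn hy]; ring
  have h2 : rate n ≤ del n / 2 := by
    have := one_lt_del hn
    have := eps_pos hn
    rw [rate]; linarith
  have h3 : rate n * (lam n * y ^ (-del n)) ≤ del n / 2 * (lam n * y ^ (-del n)) :=
    mul_le_mul_of_nonneg_right h2 (by positivity)
  rw [force]
  linarith

/-- A constant `B` for which `λ y ^ (-δ) + B` is a supersolution. -/
def barrierGap (n : ℕ) : ℝ := lam n * (6 * n ^ 2 + n) / rate n + 2 * lam n

theorem barrierGap_pos (hn : 4 ≤ n) : 0 < barrierGap n := by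
  have hl := lam_pos hn
  have hr := rate_pos hn
  rw [barrierGap]; positivity

/-- `λ y ^ (-δ) + B` is a supersolution. For small `y`, the growth of `u ^ n` at the singular
profile multiplies `B` by a multiple of `y⁻²`; since `δ ≤ 2`, this absorbs the error terms, which
are multiples of `y ^ (-δ)`. For the other `y`, the linear term suffices. -/
theorem force_upper_barrier (hn : 4 ≤ n) {y : ℝ} (hy : 0 < y) :
    lam n * (del n * (del n + 1)) * y ^ (-del n) / y ^ 2
        + lam n * (del n / 2) * y ^ (-del n) ≤
      force n y (lam n * y ^ (-del n) + barrierGap n) := by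
  have hl := lam_pos hn
  have hX : 0 < y ^ (-del n) := Real.rpow_pos_of_pos hy _
  have hk := kap_pos
  have hm := mu1_pos hy
  have hr := rate_pos hn
  have hB := barrierGap_pos hn
  have hn4 := cast_ge_four hn
  have hd1 := one_lt_del hn
  have hd2 := del_le_two hn
  have hb := del_mul_pos hn
  have hXy : y ≤ 1 → y ^ (-del n) ≤ 1 / y ^ 2 := by
    intro h
    have h1 : y ^ (-del n) ≤ y ^ (-2 : ℝ) :=
      Real.rpow_le_rpow_of_exponent_ge hy h (by linarith)
    rwa [Real.rpow_neg hy.le 2, Real.rpow_two, ← one_div] at h1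
  generalize hXd : y ^ (-del n) = X at *
  rcases le_or_gt ((n : ℝ) * y ^ 2) 1 with hc | hc
  · have hy1 : y ≤ 1 := by nlinarith
    have hXy' := hXy hy1
    -- `coef(y) y⁻ⁿ` is bounded below, as `μ₁(y) ≥ κ y exp (-y² / 4)`.
    have h1 : (1 - n * y ^ 2 / 2) * (2 * kap * y) ^ n ≤ coef n y := by
      have h2 : kap * y * Real.exp (-(y ^ 2 / 4)) ≤ mu1 y := by
        have := le_mu1 hy.le
        rwa [neg_div] at this
      have h3 : 1 - n * y ^ 2 / 2 ≤ Real.exp (-(y ^ 2 / 4) + -(y ^ 2 / 4)) ^ n := by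
        rw [← Real.exp_nat_mul]
        refine le_trans ?_ (Real.add_one_le_exp _)
        linarith
      calc (1 - n * y ^ 2 / 2) * (2 * kap * y) ^ n
          ≤ Real.exp (-(y ^ 2 / 4) + -(y ^ 2 / 4)) ^ n * (2 * kap * y) ^ n := by gcongr
        _ = 1 * (2 * (kap * y * Real.exp (-(y ^ 2 / 4))) * Real.exp (-(y ^ 2 / 4))) ^ n := by
            rw [Real.exp_add, ← mul_pow, one_mul]; congr 1; ring
        _ ≤ Real.exp (y ^ 2 / 4) * (2 * mu1 y * Real.exp (-(y ^ 2 / 4))) ^ n := by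
            have : 1 ≤ Real.exp (y ^ 2 / 4) := Real.one_le_exp (by positivity)
            gcongr
    have h2 : (lam n * X) ^ n * (1 + n * (barrierGap n / (lam n * X))) ≤
        (lam n * X + barrierGap n) ^ n := by
      have h3 := one_add_mul_le_pow (a := barrierGap n / (lam n * X))
        (by have : 0 ≤ barrierGap n / (lam n * X) := by positivity
            linarith) n
      calc _ ≤ (lam n * X) ^ n * (1 + barrierGap n / (lam n * X)) ^ n := by gcongr
        _ = _ := by rw [← mul_pow]; congr 1; field_simp
    have h4 : (1 - n * y ^ 2 / 2) * (del n * (del n + 1)) *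
        (lam n * X / y ^ 2 + n * barrierGap n / y ^ 2) ≤
        coef n y * (lam n * X + barrierGap n) ^ n := by
      calc _ = (1 - n * y ^ 2 / 2) * (2 * kap * y) ^ n *
            ((lam n * X) ^ n * (1 + n * (barrierGap n / (lam n * X)))) := by
            have h5 : (2 * kap * y) ^ n * (lam n * X) ^ n
                = del n * (del n + 1) * lam n * (X / y ^ 2) := by
              rw [← lam_pow' hn, ← hXd, ← mul_rpow_neg_del_pow hn hy, ← mul_pow, ← mul_pow,
                ← mul_pow]
              congr 1; ring
            calc _ = (1 - n * y ^ 2 / 2) * (del n * (del n + 1) * lam n * (X / y ^ 2)) *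
                  (1 + n * (barrierGap n / (lam n * X))) := by field_simp
              _ = _ := by rw [← h5]; ring
        _ ≤ _ := by
            have : 0 ≤ coef n y := (coef_pos hy).le
            gcongr
    have hB2 : 2 * lam n ≤ barrierGap n := by
      have : 0 ≤ lam n * (6 * n ^ 2 + n) / rate n := by positivity
      rw [barrierGap]; linarith
    have h5 : (1 - n * y ^ 2 / 2) * (del n * (del n + 1)) *
        (lam n * X / y ^ 2 + n * barrierGap n / y ^ 2)
        = lam n * (del n * (del n + 1)) * X / y ^ 2 - n / 2 * (del n * (del n + 1)) * (lam n * X)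
          + (1 - n * y ^ 2 / 2) * (del n * (del n + 1) * n * barrierGap n * (1 / y ^ 2)) := by
      field_simp
    have h6 : 1 / 2 * (del n * (del n + 1) * n * (2 * lam n) * X) ≤
        (1 - n * y ^ 2 / 2) * (del n * (del n + 1) * n * barrierGap n * (1 / y ^ 2)) := by
      have : 1 / 2 ≤ 1 - n * y ^ 2 / 2 := by linarith
      gcongr
    have h7 : del n / 2 * (lam n * X) ≤ n / 2 * (del n * (del n + 1)) * (lam n * X) := by
      refine mul_le_mul_of_nonneg_right ?_ (by positivity)
      nlinarith
    have h8 : 0 ≤ rate n * (lam n * X + barrierGap n) := by positivity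
    rw [force]
    linarith
  · have hXn : X ≤ n := by
      rcases le_or_gt y 1 with h | h
      · refine (hXy h).trans ?_
        rw [div_le_iff₀ (by positivity)]
        exact hc.le
      · have : X ≤ 1 := by
          rw [← hXd]
          exact Real.rpow_le_one_of_one_le_of_nonpos h.le (by linarith)
        linarith
    have hyn : 1 / y ^ 2 ≤ n := by
      rw [div_le_iff₀ (by positivity)]
      exact hc.le
    have h1 : lam n * (6 * n ^ 2 + n) ≤ rate n * barrierGap n := by
      have : rate n * barrierGap n = lam n * (6 * n ^ 2 + n) + 2 * rate n * lam n := by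
        rw [barrierGap]; field_simp
      have : 0 < 2 * rate n * lam n := by positivity
      linarith
    have h2 : lam n * (del n * (del n + 1)) * X / y ^ 2 ≤ lam n * (2 * (2 + 1)) * n * n := by
      rw [← mul_one_div]
      gcongr
    have h3 : lam n * (del n / 2) * X ≤ lam n * (2 / 2) * n := by gcongr
    have h4 : 0 ≤ coef n y * (lam n * X + barrierGap n) ^ n := by
      have := coef_pos (n := n) hy
      positivity
    have h5 : 0 ≤ rate n * (lam n * X) := by positivity
    rw [force]
    linarith

end Barriers

/-! ### Existence -/

section Existence

variable {n : ℕ}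

theorem continuous_exp_sq_div : Continuous fun y : ℝ => Real.exp (y ^ 2 / 4) := by fun_prop

theorem hasDerivAt_exp_sq_div (y : ℝ) :
    HasDerivAt (fun x : ℝ => Real.exp (x ^ 2 / 4)) (y / 2 * Real.exp (y ^ 2 / 4)) y := by
  convert! hasDerivAt_exp_sq (1 / 4) y using 1
  · ext x; ring_nf
  · ring_nf

/-- From the first-order system for `(u, exp (-y² / 4) u')` to the second-order equation. -/
theorem hasDerivAt_exp_sq_div_mul {w : ℝ → ℝ} {y f : ℝ}
    (hw : HasDerivAt w (Real.exp (-(y ^ 2 / 4)) * f) y) :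
    HasDerivAt (fun x => Real.exp (x ^ 2 / 4) * w x)
      (y / 2 * (Real.exp (y ^ 2 / 4) * w y) + f) y := by
  convert! (hasDerivAt_exp_sq_div y).mul hw using 1
  rw [← mul_assoc (Real.exp _) (Real.exp _), ← Real.exp_add]
  simp
  ring

/-- The solution of the boundary value problem on `[α, β]` with the supersolution as boundary
values lies between the barriers. -/
theorem exists_between_barriers (hn : 4 ≤ n) {α β : ℝ} (hα : 0 < α) (hαβ : α < β) :
    ∃ u w : ℝ → ℝ, ContinuousOn u (Set.Icc α β) ∧
      u α = lam n * α ^ (-del n) + barrierGap n ∧ u β = lam n * β ^ (-del n) + barrierGap n ∧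
      (∀ t ∈ Set.Icc α β, lam n * t ^ (-del n) ≤ u t ∧
        u t ≤ lam n * t ^ (-del n) + barrierGap n) ∧
      ∀ t ∈ Set.Ioo α β, HasDerivAt u (Real.exp (t ^ 2 / 4) * w t) t ∧
        HasDerivAt w (Real.exp (-(t ^ 2 / 4)) * force n t (u t)) t := by
  have hl := lam_pos hn
  have hB := barrierGap_pos hn
  have hd := one_lt_del hn
  have hr := rate_pos hn
  have hpos : ∀ t ∈ Set.Icc α β, 0 < t := fun t ht => hα.trans_le ht.1
  set M : ℝ := lam n * α ^ (-del n) + barrierGap n with hM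
  have hX : ∀ t : ℝ, 0 < t → 0 < lam n * t ^ (-del n) := fun t ht =>
    mul_pos hl (Real.rpow_pos_of_pos ht _)
  have hM0 : 0 ≤ M := (add_pos (hX α hα) hB).le
  have hMt : ∀ t ∈ Set.Icc α β, lam n * t ^ (-del n) + barrierGap n ≤ M := by
    intro t ht
    have := Real.rpow_le_rpow_of_nonpos hα ht.1 (by linarith : -del n ≤ 0)
    have := mul_le_mul_of_nonneg_left this hl.le
    linarith
  -- The nonlinearity is truncated to `[0, M]`.
  set cl : ℝ → ℝ := fun x => max 0 (min M x) with hcl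
  have hcl0 : ∀ x, 0 ≤ cl x := fun x => le_max_left _ _
  have hclM : ∀ x, cl x ≤ M := fun x => max_le hM0 (min_le_left _ _)
  have hclid : ∀ x, 0 ≤ x → x ≤ M → cl x = x := fun x h0 h1 => by
    simp only [hcl, min_eq_right h1, max_eq_right h0]
  have hclmono : Monotone cl := fun x z h => max_le_max le_rfl (min_le_min le_rfl h)
  have hclL : ∀ x z, |cl x - cl z| ≤ |x - z| := fun x z =>
    (abs_max_sub_max_le_max 0 (min M x) 0 (min M z)).trans (by
      simpa using (abs_min_sub_min_le_max M x M z).trans (by simp))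
  obtain ⟨C, hC⟩ := isCompact_Icc.exists_bound_of_continuousOn
    (continuous_coef (n := n)).continuousOn (s := Set.Icc α β)
  have hC0 : 0 ≤ C := (norm_nonneg _).trans (hC α ⟨le_rfl, hαβ.le⟩)
  have hC' : ∀ t ∈ Set.Icc α β, coef n t ≤ C := fun t ht => (le_abs_self _).trans (hC t ht)
  have hexp1 : ∀ t : ℝ, Real.exp (-(t ^ 2 / 4)) ≤ 1 := fun t =>
    Real.exp_le_one_iff.2 (by nlinarith [sq_nonneg t])
  set K : ℝ := rate n + C * (n * M ^ (n - 1)) with hK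
  have hK0 : 0 ≤ K := by positivity
  have hforceL : ∀ t ∈ Set.Icc α β, ∀ x z, |force n t (cl x) - force n t (cl z)| ≤ K * |x - z| := by
    intro t ht x z
    have h1 : |cl x ^ n - cl z ^ n| ≤ |x - z| * (n * M ^ (n - 1)) := by
      refine (abs_pow_sub_pow_le _ _ _).trans ?_
      rw [mul_assoc]
      have : max |cl x| |cl z| ≤ M :=
        max_le (by rw [abs_of_nonneg (hcl0 x)]; exact hclM x)
          (by rw [abs_of_nonneg (hcl0 z)]; exact hclM z)
      have h3 := hclL x z
      gcongr
    have h2 : force n t (cl x) - force n t (cl z)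
        = rate n * (cl x - cl z) + coef n t * (cl x ^ n - cl z ^ n) := by
      rw [force, force]; ring
    rw [h2]
    refine (abs_add_le _ _).trans ?_
    rw [abs_mul, abs_mul, abs_of_pos hr, abs_of_pos (coef_pos (hpos t ht))]
    have h3 := mul_le_mul_of_nonneg_left (hclL x z) hr.le
    have h4 : coef n t * |cl x ^ n - cl z ^ n| ≤ C * (|x - z| * (n * M ^ (n - 1))) :=
      mul_le_mul (hC' t ht) h1 (abs_nonneg _) hC0
    rw [hK]
    linarith
  obtain ⟨u, w, huα, huβ, hder⟩ := exists_boundary_value (α := α) (β := β)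
    (A := M) (B := lam n * β ^ (-del n) + barrierGap n)
    (r := fun t => Real.exp (t ^ 2 / 4)) (R₀ := Real.exp (β ^ 2 / 4))
    (F := fun t x => Real.exp (-(t ^ 2 / 4)) * force n t (cl x)) (K := K.toNNReal)
    (N := rate n * M + C * M ^ n) hαβ continuous_exp_sq_div.continuousOn
    (fun t _ => Real.one_le_exp (by positivity))
    (fun t ht => Real.exp_le_exp.2 (by
      have := pow_le_pow_left₀ (hpos t ht).le ht.2 2
      linarith))
    (fun x => by
      have := continuous_coef (n := n)
      unfold force
      fun_prop)
    (fun t ht => LipschitzWith.of_dist_le_mul fun x z => by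
      rw [Real.dist_eq, Real.dist_eq, ← mul_sub, abs_mul, abs_of_pos (Real.exp_pos _),
        Real.coe_toNNReal K hK0]
      calc _ ≤ 1 * |force n t (cl x) - force n t (cl z)| := by
            have := hexp1 t
            gcongr
        _ ≤ _ := by
            rw [one_mul]
            exact hforceL t ht x z)
    (fun t ht x => mul_nonneg (Real.exp_pos _).le (force_nonneg hn (hpos t ht) (hcl0 x)))
    (fun t ht x => by
      have h0 := force_nonneg hn (hpos t ht) (hcl0 x)
      have h1 := hC' t ht
      have h2 := hclM x
      have h3 := hcl0 x
      calc _ ≤ 1 * force n t (cl x) := by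
            have := hexp1 t
            gcongr
        _ = rate n * cl x + coef n t * cl x ^ n := by rw [one_mul, force]
        _ ≤ _ := by gcongr)
  have hu : ∀ t ∈ Set.Ioo α β, HasDerivAt u (Real.exp (t ^ 2 / 4) * w t) t := fun t ht =>
    (hder t (Set.Ioo_subset_Icc_self ht)).1.hasDerivAt (Icc_mem_nhds ht.1 ht.2)
  have hw : ∀ t ∈ Set.Ioo α β,
      HasDerivAt w (Real.exp (-(t ^ 2 / 4)) * force n t (cl (u t))) t := fun t ht =>
    (hder t (Set.Ioo_subset_Icc_self ht)).2.hasDerivAt (Icc_mem_nhds ht.1 ht.2)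
  have hu2 := fun t ht => hasDerivAt_exp_sq_div_mul (hw t ht)
  have hcont : ContinuousOn u (Set.Icc α β) := fun t ht => (hder t ht).1.continuousWithinAt
  have hs1 : ∀ t : ℝ, 0 < t → HasDerivAt (fun t : ℝ => lam n * t ^ (-del n))
      (lam n * -del n * t ^ (-del n) / t) t := fun t ht => hasDerivAt_const_mul_rpow _ _ ht
  have hs2 : ∀ t : ℝ, 0 < t → HasDerivAt (fun t : ℝ => lam n * -del n * t ^ (-del n) / t)
      (lam n * -del n * (-del n - 1) * t ^ (-del n) / t ^ 2) t := fun t ht =>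
    hasDerivAt_const_mul_rpow_div _ _ ht
  have hL : ∀ t : ℝ, 0 < t → lam n * -del n * (-del n - 1) * t ^ (-del n) / t ^ 2
      - t / 2 * (lam n * -del n * t ^ (-del n) / t)
      = lam n * (del n * (del n + 1)) * t ^ (-del n) / t ^ 2
        + lam n * (del n / 2) * t ^ (-del n) := by
    intro t ht
    field_simp
    ring
  have hscont : ContinuousOn (fun t : ℝ => lam n * t ^ (-del n)) (Set.Icc α β) := fun t ht =>
    (hs1 t (hpos t ht)).continuousAt.continuousWithinAt
  have hupper : ∀ t ∈ Set.Icc α β, u t - (lam n * t ^ (-del n) + barrierGap n) ≤ 0 := by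
    refine nonpos_of_weak_subsolution (hcont.sub (hscont.add continuousOn_const))
      (fun t ht => (hu t ht).sub ((hs1 t (hα.trans ht.1)).add_const _))
      (fun t ht => (hu2 t ht).sub (hs2 t (hα.trans ht.1))) (fun t ht hdt => ?_) ?_ ?_
    · have ht0 := hα.trans ht.1
      have h1 := hMt t (Set.Ioo_subset_Icc_self ht)
      have h2 := hclmono (by linarith : lam n * t ^ (-del n) + barrierGap n ≤ u t)
      rw [hclid _ (add_pos (hX t ht0) hB).le h1] at h2
      have h3 := force_mono hn ht0 (add_pos (hX t ht0) hB).le h2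
      have h4 := force_upper_barrier hn ht0
      have h5 := hL t ht0
      linarith
    · rw [huα]; simp [hM]
    · rw [huβ]; simp
  have hlower : ∀ t ∈ Set.Icc α β, lam n * t ^ (-del n) - u t ≤ 0 := by
    refine nonpos_of_weak_subsolution (hscont.sub hcont)
      (fun t ht => (hs1 t (hα.trans ht.1)).sub (hu t ht))
      (fun t ht => (hs2 t (hα.trans ht.1)).sub (hu2 t ht)) (fun t ht hdt => ?_) ?_ ?_
    · have ht0 := hα.trans ht.1
      have h1 := hMt t (Set.Ioo_subset_Icc_self ht)
      have h2 := hclmono (by linarith : u t ≤ lam n * t ^ (-del n))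
      rw [hclid _ (hX t ht0).le (by linarith)] at h2
      have h3 := force_mono hn ht0 (hcl0 _) h2
      have h4 := force_lower_barrier hn ht0
      have h5 := hL t ht0
      linarith
    · rw [huα, hM]; linarith
    · rw [huβ]; linarith
  have hbd : ∀ t ∈ Set.Icc α β, lam n * t ^ (-del n) ≤ u t ∧
      u t ≤ lam n * t ^ (-del n) + barrierGap n := fun t ht =>
    ⟨by linarith [hlower t ht], by linarith [hupper t ht]⟩
  refine ⟨u, w, hcont, huα, huβ, hbd, fun t ht => ⟨hu t ht, ?_⟩⟩
  have ht' := Set.Ioo_subset_Icc_self ht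
  have h := hw t ht
  rwa [hclid _ ((hX t (hpos t ht')).le.trans (hbd t ht').1)
    ((hbd t ht').2.trans (hMt t ht'))] at h

/-- A solution on `(0, ∞)` between the barriers, as the decreasing limit of solutions on compact
intervals. -/
theorem exists_global_between_barriers (hn : 4 ≤ n) :
    ∃ u w : ℝ → ℝ, ∀ y, 0 < y →
      (lam n * y ^ (-del n) ≤ u y ∧ u y ≤ lam n * y ^ (-del n) + barrierGap n) ∧
      HasDerivAt u (Real.exp (y ^ 2 / 4) * w y) y ∧
      HasDerivAt w (Real.exp (-(y ^ 2 / 4)) * force n y (u y)) y := by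
  have hl := lam_pos hn
  have hB := barrierGap_pos hn
  have hX : ∀ t : ℝ, 0 < t → 0 < lam n * t ^ (-del n) := fun t ht =>
    mul_pos hl (Real.rpow_pos_of_pos ht _)
  set α : ℕ → ℝ := fun k => 1 / ((k : ℝ) + 2) with hαdef
  set β : ℕ → ℝ := fun k => (k : ℝ) + 2 with hβdef
  have hα : ∀ k, 0 < α k := fun k => by simp only [hαdef]; positivity
  have hαβ : ∀ k, α k < β k := fun k => by
    simp only [hαdef, hβdef]
    have : (0 : ℝ) ≤ k := by positivity
    rw [div_lt_iff₀ (by positivity)]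
    nlinarith
  have hαanti : ∀ k, α (k + 1) < α k := fun k => by
    simp only [hαdef]
    push_cast
    exact one_div_lt_one_div_of_lt (by positivity) (by linarith)
  have hβmono : ∀ k, β k < β (k + 1) := fun k => by
    simp only [hβdef]
    push_cast
    linarith
  have hαlim : Tendsto α atTop (𝓝 0) := by
    have := tendsto_one_div_add_atTop_nhds_zero_nat (𝕜 := ℝ)
    refine (this.comp (tendsto_add_atTop_nat 1)).congr fun k => ?_
    simp only [hαdef, Function.comp]
    push_cast
    ring
  have hβlim : Tendsto β atTop atTop :=
    tendsto_atTop_add_const_right _ _ tendsto_natCast_atTop_atTop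
  choose U W hUc hUα hUβ hbar hder using fun k => exists_between_barriers hn (hα k) (hαβ k)
  have hU2 := fun k t ht => hasDerivAt_exp_sq_div_mul (hder k t ht).2
  have hexh : ∀ c d : ℝ, 0 < c → ∀ᶠ k in atTop, Set.Icc c d ⊆ Set.Ioo (α k) (β k) := by
    intro c d hc
    filter_upwards [hαlim.eventually_lt_const hc, hβlim.eventually_gt_atTop d] with k h1 h2 y hy
    exact ⟨h1.trans_le hy.1, hy.2.trans_lt h2⟩
  -- The next solution is below the supersolution at the ends of the interval, hence decreasing.
  have hanti : ∀ k, ∀ y ∈ Set.Icc (α k) (β k), U (k + 1) y ≤ U k y := by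
    intro k
    have hI : Set.Icc (α k) (β k) ⊆ Set.Ioo (α (k + 1)) (β (k + 1)) := fun y hy =>
      ⟨(hαanti k).trans_le hy.1, hy.2.trans_lt (hβmono k)⟩
    have hI' := hI.trans Set.Ioo_subset_Icc_self
    have := nonpos_of_weak_subsolution (d := fun y => U (k + 1) y - U k y)
      (((hUc (k + 1)).mono hI').sub (hUc k))
      (fun t ht => (hder (k + 1) t (hI (Set.Ioo_subset_Icc_self ht))).1.sub (hder k t ht).1)
      (fun t ht => (hU2 (k + 1) t (hI (Set.Ioo_subset_Icc_self ht))).sub (hU2 k t ht))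
      (fun t ht hdt => by
        have ht0 := (hα k).trans ht.1
        have h1 := (hbar k t (Set.Ioo_subset_Icc_self ht)).1
        have h2 := force_mono hn ht0 ((hX t ht0).le.trans h1) (by linarith : U k t ≤ U (k + 1) t)
        linarith)
      (by
        have := (hbar (k + 1) (α k) (hI' ⟨le_rfl, (hαβ k).le⟩)).2
        rw [hUα k]
        linarith)
      (by
        have := (hbar (k + 1) (β k) (hI' ⟨(hαβ k).le, le_rfl⟩)).2
        rw [hUβ k]
        linarith)
    intro y hy
    have := this y hy
    linarith
  have hlim : ∀ y, 0 < y → ∃ x, Tendsto (fun k => U k y) atTop (𝓝 x) := by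
    intro y hy
    obtain ⟨k₀, hk₀⟩ := eventually_atTop.1 (hexh y y hy)
    have hmem : ∀ k, y ∈ Set.Icc (α (k + k₀)) (β (k + k₀)) := fun k =>
      Set.Ioo_subset_Icc_self (hk₀ (k + k₀) (by omega) ⟨le_rfl, le_rfl⟩)
    have h1 : Antitone fun k => U (k + k₀) y := antitone_nat_of_succ_le fun k => by
      have := hanti (k + k₀) y (hmem k)
      rwa [show k + k₀ + 1 = k + 1 + k₀ by ring] at this
    have h2 : BddBelow (Set.range fun k => U (k + k₀) y) :=
      ⟨lam n * y ^ (-del n), by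
        rintro _ ⟨k, rfl⟩
        exact (hbar _ y (hmem k)).1⟩
    exact ⟨_, (tendsto_add_atTop_iff_nat k₀).1 (tendsto_atTop_ciInf h1 h2)⟩
  choose! u hu using hlim
  obtain ⟨w, hw⟩ := hasDerivAt_of_tendsto_solutions (U := U) (W := W) (u := u)
    (r := fun y => Real.exp (y ^ 2 / 4))
    (Φ := fun y x => Real.exp (-(y ^ 2 / 4)) * force n y x) continuous_exp_sq_div
    (fun y => Real.exp_pos _)
    (by
      have := continuous_force (n := n)
      exact Continuous.mul (by fun_prop) this)
    (fun c d hc _ => by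
      filter_upwards [hexh c d hc] with k hk y hy using hder k y (hk hy))
    (fun c d hc hcd => by
      have hcont : ContinuousOn
          (fun y => Real.exp (-(y ^ 2 / 4)) * force n y (lam n * y ^ (-del n) + barrierGap n))
          (Set.Icc c d) := by
        refine ContinuousOn.mul (by fun_prop) ?_
        refine (continuous_force (n := n)).comp_continuousOn (continuousOn_id.prodMk ?_)
        refine ContinuousOn.add (fun y hy => ?_) continuousOn_const
        exact (hasDerivAt_const_mul_rpow _ _ (hc.trans_le hy.1)).continuousAt.continuousWithinAt
      obtain ⟨C, hC⟩ := isCompact_Icc.exists_bound_of_continuousOn hcont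
      refine ⟨C, ?_⟩
      filter_upwards [hexh c d hc] with k hk y hy
      have hy0 := hc.trans_le hy.1
      have hb := hbar k y (Set.Ioo_subset_Icc_self (hk hy))
      have h0 : 0 ≤ U k y := (hX y hy0).le.trans hb.1
      have h1 := force_nonneg hn hy0 h0
      rw [abs_of_nonneg (mul_nonneg (Real.exp_pos _).le h1)]
      refine le_trans ?_ ((le_abs_self _).trans (hC y hy))
      exact mul_le_mul_of_nonneg_left (force_mono hn hy0 h0 hb.2) (Real.exp_pos _).le) hu
  refine ⟨u, w, fun y hy => ⟨⟨?_, ?_⟩, hw y hy⟩⟩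
  · refine ge_of_tendsto (hu y hy) ?_
    filter_upwards [hexh y y hy] with k hk
    exact (hbar k y (Set.Ioo_subset_Icc_self (hk ⟨le_rfl, le_rfl⟩))).1
  · refine le_of_tendsto (hu y hy) ?_
    filter_upwards [hexh y y hy] with k hk
    exact (hbar k y (Set.Ioo_subset_Icc_self (hk ⟨le_rfl, le_rfl⟩))).2

end Existence

/-! ### Passing between `μ` and `exp (y² / 4) μ` -/

section Transform

variable {n : ℕ}

theorem IsPositiveSolution.hasDerivAt {μ : ℝ → ℝ} (h : IsPositiveSolution n μ) {y : ℝ}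
    (hy : 0 < y) : HasDerivAt μ (deriv μ y) y :=
  (h.differentiable.differentiableAt (Ioi_mem_nhds hy)).hasDerivAt

theorem IsPositiveSolution.hasDerivAt_deriv {μ : ℝ → ℝ} (h : IsPositiveSolution n μ) {y : ℝ}
    (hy : 0 < y) : HasDerivAt (deriv μ) (deriv (deriv μ) y) y :=
  (h.differentiable_deriv.differentiableAt (Ioi_mem_nhds hy)).hasDerivAt

theorem coef_mul_pow (y x : ℝ) :
    coef n y * x ^ n = Real.exp (y ^ 2 / 4) * (2 * mu1 y * (Real.exp (-(y ^ 2 / 4)) * x)) ^ n := by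
  rw [coef, mul_assoc, ← mul_pow, ← mul_assoc (2 * mu1 y)]

/-- The equation for `u = exp (y² / 4) μ`. -/
theorem IsPositiveSolution.exp_mul {μ : ℝ → ℝ} (h : IsPositiveSolution n μ) {y : ℝ} (hy : 0 < y) :
    HasDerivAt (fun x => Real.exp (x ^ 2 / 4) * μ x)
      (Real.exp (y ^ 2 / 4) * (deriv μ y + y / 2 * μ y)) y ∧
    HasDerivAt (fun x => Real.exp (x ^ 2 / 4) * (deriv μ x + x / 2 * μ x))
      (y / 2 * (Real.exp (y ^ 2 / 4) * (deriv μ y + y / 2 * μ y))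
        + force n y (Real.exp (y ^ 2 / 4) * μ y)) y := by
  have he := hasDerivAt_exp_sq_div y
  have h1 := h.hasDerivAt hy
  have h2 := h.hasDerivAt_deriv hy
  have hid : HasDerivAt (fun x : ℝ => x / 2) (1 / 2) y := (hasDerivAt_id y).div_const 2
  refine ⟨?_, ?_⟩
  · convert! he.mul h1 using 1
    ring
  · convert! he.mul (h2.add (hid.mul h1)) using 1
    have hode := h.ode y hy
    rw [force, coef_mul_pow, ← mul_assoc (Real.exp (-(y ^ 2 / 4))), ← Real.exp_add]
    simp only [neg_add_cancel, Real.exp_zero, one_mul]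
    rw [← hode, rate, Pi.add_apply, Pi.mul_apply]
    ring

theorem tendsto_mul_exp_neg_sq :
    Tendsto (fun y : ℝ => y * Real.exp (-(y ^ 2 / 4))) atTop (𝓝 0) := by
  have h : Tendsto (fun y : ℝ => 4 / y) atTop (𝓝 0) := tendsto_const_nhds.div_atTop tendsto_id
  refine squeeze_zero' ?_ ?_ h
  · filter_upwards [eventually_ge_atTop 0] with y hy
    positivity
  · filter_upwards [eventually_gt_atTop 0] with y hy
    have h1 : y ^ 2 / 4 * Real.exp (-(y ^ 2 / 4)) ≤ 1 := by
      rw [Real.exp_neg, ← div_eq_mul_inv, div_le_one (Real.exp_pos _)]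
      linarith [Real.add_one_le_exp (y ^ 2 / 4)]
    rw [le_div_iff₀ hy]
    linarith

theorem exists_isPositiveSolution (hn : 4 ≤ n) : ∃ μ, IsPositiveSolution n μ := by
  obtain ⟨u, w, hu⟩ := exists_global_between_barriers hn
  have hl := lam_pos hn
  have hB := barrierGap_pos hn
  have hd := one_lt_del hn
  have hX : ∀ t : ℝ, 0 < t → 0 < t ^ (-del n) := fun t ht => Real.rpow_pos_of_pos ht _
  have hupos : ∀ y, 0 < y → 0 < u y := fun y hy =>
    (mul_pos hl (hX y hy)).trans_le (hu y hy).1.1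
  have he : ∀ y : ℝ, HasDerivAt (fun x : ℝ => Real.exp (-(x ^ 2 / 4)))
      (-(y / 2) * Real.exp (-(y ^ 2 / 4))) y := fun y => by
    convert! hasDerivAt_exp_sq (-(1 / 4)) y using 1
    · ext x; ring_nf
    · ring_nf
  have hid : ∀ y, HasDerivAt (fun x : ℝ => x / 2) (1 / 2) y := fun y =>
    (hasDerivAt_id y).div_const 2
  set u₁ : ℝ → ℝ := fun y => Real.exp (y ^ 2 / 4) * w y with hu₁
  have h1 : ∀ y, 0 < y → HasDerivAt u (u₁ y) y := fun y hy => (hu y hy).2.1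
  have h2 : ∀ y, 0 < y → HasDerivAt u₁ (y / 2 * u₁ y + force n y (u y)) y := fun y hy =>
    hasDerivAt_exp_sq_div_mul (hu y hy).2.2
  set μ : ℝ → ℝ := fun y => Real.exp (-(y ^ 2 / 4)) * u y with hμ
  have hμ1 : ∀ y, 0 < y → HasDerivAt μ (Real.exp (-(y ^ 2 / 4)) * (u₁ y - y / 2 * u y)) y :=
    fun y hy => by
      convert! (he y).mul (h1 y hy) using 1
      ring
  have hμ2 : ∀ y, 0 < y → HasDerivAt (fun y => Real.exp (-(y ^ 2 / 4)) * (u₁ y - y / 2 * u y))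
      (Real.exp (-(y ^ 2 / 4)) * (-(y / 2) * (u₁ y - y / 2 * u y)
        + (y / 2 * u₁ y + force n y (u y) - (1 / 2 * u y + y / 2 * u₁ y)))) y := fun y hy => by
    convert! (he y).mul ((h2 y hy).sub ((hid y).mul (h1 y hy))) using 1
    simp
    ring
  have hd1 : ∀ y, 0 < y → deriv μ =ᶠ[𝓝 y]
      fun y => Real.exp (-(y ^ 2 / 4)) * (u₁ y - y / 2 * u y) := fun y hy => by
    filter_upwards [Ioi_mem_nhds hy] with x hx using (hμ1 x hx).deriv
  have hμ3 := fun y hy => (hμ2 y hy).congr_of_eventuallyEq (hd1 y hy)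
  refine ⟨μ, fun y hy => mul_pos (Real.exp_pos _) (hupos y hy),
    fun y hy => (hμ1 y hy).differentiableAt.differentiableWithinAt,
    fun y hy => (hμ3 y hy).differentiableAt.differentiableWithinAt, fun y hy => ?_, ?_, ?_⟩
  · rw [(hμ3 y hy).deriv, (hd1 y hy).eq_of_nhds]
    have h3 : Real.exp (-(y ^ 2 / 4)) * (coef n y * u y ^ n) = (2 * mu1 y * μ y) ^ n := by
      rw [coef_mul_pow, ← mul_assoc, ← Real.exp_add]
      simp [hμ]
    rw [← h3, force, rate, hμ]
    ring
  · have hlim1 : Tendsto (fun y : ℝ => Real.exp (-(y ^ 2 / 4)) * lam n) (𝓝[>] 0) (𝓝 (lam n)) := by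
      have : Continuous fun y : ℝ => Real.exp (-(y ^ 2 / 4)) * lam n := by fun_prop
      simpa using (this.tendsto 0).mono_left nhdsWithin_le_nhds
    have hlim2 : Tendsto (fun y : ℝ => Real.exp (-(y ^ 2 / 4)) * (lam n + barrierGap n * y ^ del n))
        (𝓝[>] 0) (𝓝 (lam n)) := by
      have : ContinuousAt (fun y : ℝ =>
          Real.exp (-(y ^ 2 / 4)) * (lam n + barrierGap n * y ^ del n)) 0 := by
        have := Real.continuousAt_rpow_const 0 (del n) (Or.inr (by linarith))
        fun_prop
      have h := this.tendsto.mono_left (nhdsWithin_le_nhds (s := Set.Ioi 0))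
      simpa [Real.zero_rpow (by linarith : del n ≠ 0)] using h
    have hXd : ∀ y : ℝ, 0 < y → y ^ (-del n) * y ^ del n = 1 := fun y hy => by
      rw [← Real.rpow_add hy, neg_add_cancel, Real.rpow_zero]
    refine tendsto_of_tendsto_of_tendsto_of_le_of_le' hlim1 hlim2 ?_ ?_
    · filter_upwards [self_mem_nhdsWithin] with y hy
      have h4 := mul_le_mul_of_nonneg_right (hu y hy).1.1 (Real.rpow_pos_of_pos hy (del n)).le
      rw [mul_assoc, hXd y hy, mul_one] at h4
      simp only [hμ, mul_assoc]
      exact mul_le_mul_of_nonneg_left h4 (Real.exp_pos _).le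
    · filter_upwards [self_mem_nhdsWithin] with y hy
      have h4 := mul_le_mul_of_nonneg_right (hu y hy).1.2 (Real.rpow_pos_of_pos hy (del n)).le
      rw [add_mul, mul_assoc, hXd y hy, mul_one] at h4
      simp only [hμ, mul_assoc]
      exact mul_le_mul_of_nonneg_left h4 (Real.exp_pos _).le
  · have h := tendsto_mul_exp_neg_sq.const_mul (lam n + barrierGap n)
    rw [mul_zero] at h
    refine squeeze_zero' ?_ ?_ h
    · filter_upwards [eventually_gt_atTop 0] with y hy
      have := hupos y hy
      simp only [hμ]
      positivity
    · filter_upwards [eventually_ge_atTop 1] with y hy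
      have hy0 : 0 < y := by linarith
      have hX1 : y ^ (-del n) ≤ 1 := Real.rpow_le_one_of_one_le_of_nonpos hy (by linarith)
      have h5 : u y ≤ lam n + barrierGap n := by
        have := (hu y hy0).1.2
        have := mul_le_mul_of_nonneg_left hX1 hl.le
        linarith
      have h6 : y ^ (2 * eps n) ≤ y := by
        have := Real.rpow_le_rpow_of_exponent_le hy (by linarith [eps_le hn] : 2 * eps n ≤ 1)
        rwa [Real.rpow_one] at this
      have h7 := (hupos y hy0).le
      calc Real.exp (-(y ^ 2 / 4)) * u y * y ^ (2 * eps n)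
          ≤ Real.exp (-(y ^ 2 / 4)) * (lam n + barrierGap n) * y := by gcongr
        _ = _ := by ring

end Transform

/-! ### The expansion at zero -/

section NearZero

open Asymptotics

variable {n : ℕ}

theorem isBigO_mul_expansion {l : Filter ℝ} {f g z : ℝ → ℝ} {a₀ a₁ a₂ b₀ b₁ b₂ : ℝ}
    (hz : Tendsto z l (𝓝 0))
    (hf : (fun y => f y - (a₀ + a₁ * z y + a₂ * z y ^ 2)) =O[l] fun y => z y ^ 3)
    (hg : (fun y => g y - (b₀ + b₁ * z y + b₂ * z y ^ 2)) =O[l] fun y => z y ^ 3) :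
    (fun y => f y * g y - (a₀ * b₀ + (a₀ * b₁ + a₁ * b₀) * z y
      + (a₀ * b₂ + a₁ * b₁ + a₂ * b₀) * z y ^ 2)) =O[l] fun y => z y ^ 3 := by
  have hz1 : z =O[l] fun _ => (1 : ℝ) := hz.isBigO_one ℝ
  have hz3 : (fun y => z y ^ 3) =O[l] fun _ => (1 : ℝ) := by simpa using hz1.pow 3
  have hP : ∀ c₀ c₁ c₂ : ℝ, (fun y => c₀ + c₁ * z y + c₂ * z y ^ 2) =O[l] fun _ => (1 : ℝ) := by
    intro c₀ c₁ c₂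
    have : Tendsto (fun y => c₀ + c₁ * z y + c₂ * z y ^ 2) l (𝓝 (c₀ + c₁ * 0 + c₂ * 0 ^ 2)) :=
      (tendsto_const_nhds.add (hz.const_mul c₁)).add ((hz.pow 2).const_mul c₂)
    exact this.isBigO_one ℝ
  have hg1 : g =O[l] fun _ => (1 : ℝ) := by
    have := (hg.trans hz3).add (hP b₀ b₁ b₂)
    simpa using this
  have h1 : (fun y => (f y - (a₀ + a₁ * z y + a₂ * z y ^ 2)) * g y) =O[l] fun y => z y ^ 3 := by
    simpa using hf.mul hg1
  have h2 : (fun y => (a₀ + a₁ * z y + a₂ * z y ^ 2) * (g y - (b₀ + b₁ * z y + b₂ * z y ^ 2)))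
      =O[l] fun y => z y ^ 3 := by
    simpa using (hP a₀ a₁ a₂).mul hg
  have h3 : (fun y => (a₁ * b₂ + a₂ * b₁ + a₂ * b₂ * z y + 0 * z y ^ 2) * z y ^ 3)
      =O[l] fun y => z y ^ 3 := by
    simpa using (hP (a₁ * b₂ + a₂ * b₁) (a₂ * b₂) 0).mul (isBigO_refl (fun y => z y ^ 3) l)
  refine ((h1.add h2).add h3).congr_left fun y => ?_
  ring

theorem isBigO_pow_expansion {l : Filter ℝ} {f z : ℝ → ℝ} {a b : ℝ} (hz : Tendsto z l (𝓝 0))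
    (hf : (fun y => f y - (1 + a * z y + b * z y ^ 2)) =O[l] fun y => z y ^ 3) (k : ℕ) :
    (fun y => f y ^ k - (1 + k * a * z y + (k * b + k * (k - 1) / 2 * a ^ 2) * z y ^ 2))
      =O[l] fun y => z y ^ 3 := by
  induction k with
  | zero => simpa using isBigO_zero _ _
  | succ k ih =>
    refine (isBigO_mul_expansion hz ih hf).congr_left fun y => ?_
    push_cast
    ring

/-- The three-term expansion at zero. -/
def approx (n : ℕ) (y : ℝ) : ℝ :=
  lam n * y ^ (-del n) + lam n * relLam0 n * y ^ (2 - del n)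
    + lam n * relLam1 n * y ^ (4 - del n)

/-- The derivative of `approx n` on `(0, ∞)`. -/
def approxDeriv (n : ℕ) (y : ℝ) : ℝ :=
  lam n * -del n * y ^ (-del n) / y + lam n * relLam0 n * (2 - del n) * y ^ (2 - del n) / y
    + lam n * relLam1 n * (4 - del n) * y ^ (4 - del n) / y

/-- The second derivative of `approx n` on `(0, ∞)`. -/
def approxDeriv₂ (n : ℕ) (y : ℝ) : ℝ :=
  lam n * -del n * (-del n - 1) * y ^ (-del n) / y ^ 2
    + lam n * relLam0 n * (2 - del n) * (2 - del n - 1) * y ^ (2 - del n) / y ^ 2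
    + lam n * relLam1 n * (4 - del n) * (4 - del n - 1) * y ^ (4 - del n) / y ^ 2

theorem hasDerivAt_approx {y : ℝ} (hy : 0 < y) : HasDerivAt (approx n) (approxDeriv n y) y :=
  ((hasDerivAt_const_mul_rpow _ _ hy).add (hasDerivAt_const_mul_rpow _ _ hy)).add
    (hasDerivAt_const_mul_rpow _ _ hy)

theorem hasDerivAt_approxDeriv {y : ℝ} (hy : 0 < y) :
    HasDerivAt (approxDeriv n) (approxDeriv₂ n y) y :=
  ((hasDerivAt_const_mul_rpow_div _ _ hy).add (hasDerivAt_const_mul_rpow_div _ _ hy)).add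
    (hasDerivAt_const_mul_rpow_div _ _ hy)

theorem rpow_two_sub {y : ℝ} (hy : 0 < y) (s : ℝ) : y ^ (2 - s) = y ^ (-s) * y ^ 2 := by
  rw [sub_eq_add_neg, add_comm, Real.rpow_add hy, Real.rpow_two]

theorem rpow_four_sub {y : ℝ} (hy : 0 < y) (s : ℝ) : y ^ (4 - s) = y ^ (-s) * y ^ 4 := by
  rw [sub_eq_add_neg, add_comm, Real.rpow_add hy]
  norm_cast

theorem approx_eq {y : ℝ} (hy : 0 < y) :
    approx n y = lam n * y ^ (-del n) * (1 + relLam0 n * y ^ 2 + relLam1 n * y ^ 4) := by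
  rw [approx, rpow_two_sub hy, rpow_four_sub hy]; ring

theorem tendsto_sq_zero : Tendsto (fun y : ℝ => y ^ 2) (𝓝[>] 0) (𝓝 0) := by
  have : Continuous fun y : ℝ => y ^ 2 := by fun_prop
  simpa using (this.tendsto 0).mono_left (nhdsWithin_le_nhds (s := Set.Ioi 0))

theorem tendsto_mu1_div : Tendsto (fun y => mu1 y / (kap * y)) (𝓝[>] 0) (𝓝 1) := by
  have h1 : Tendsto (fun y : ℝ => Real.exp (-y ^ 2 / 4)) (𝓝[>] 0) (𝓝 1) := by
    have : Continuous fun y : ℝ => Real.exp (-y ^ 2 / 4) := by fun_prop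
    simpa using (this.tendsto 0).mono_left (nhdsWithin_le_nhds (s := Set.Ioi 0))
  have hk := kap_pos
  refine tendsto_of_tendsto_of_tendsto_of_le_of_le' h1 tendsto_const_nhds ?_ ?_
  · filter_upwards [self_mem_nhdsWithin] with y (hy : 0 < y)
    rw [le_div_iff₀ (by positivity)]
    linarith [le_mu1 hy.le]
  · filter_upwards [self_mem_nhdsWithin] with y (hy : 0 < y)
    rw [div_le_one (by positivity)]
    exact mu1_le hy.le

/-- The three-term expansion satisfies the equation up to `O(y ^ (4 - δ))`. -/
theorem approx_residual (hn : 4 ≤ n) : ∃ C, 0 < C ∧ ∀ᶠ y in 𝓝[>] (0 : ℝ),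
    |approxDeriv₂ n y + y / 2 * approxDeriv n y + eps n * approx n y
      - (2 * mu1 y * approx n y) ^ n| ≤ C * (y ^ (-del n) * y ^ 4) := by
  have hl := lam_pos hn
  have hk := kap_pos
  have hb := del_mul_pos hn
  have h0 := relLam0_eq hn
  have h1 := relLam1_eq hn
  set p := relLam0 n with hp
  set q := relLam1 n with hq
  have hm : (fun y : ℝ => mu1 y / (kap * y) - (1 + -(1 / 12) * y ^ 2 + 1 / 160 * (y ^ 2) ^ 2))
      =O[𝓝[>] 0] fun y => (y ^ 2) ^ 3 := by
    refine IsBigO.of_bound 1 ?_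
    filter_upwards [Ioc_mem_nhdsGT (show (0 : ℝ) < 2 by norm_num)] with y hy
    rw [Real.norm_eq_abs, Real.norm_of_nonneg (by positivity), one_mul]
    calc _ = |mu1 y / (kap * y) - (1 - y ^ 2 / 12 + y ^ 4 / 160)| := by congr 1; ring
      _ ≤ y ^ 6 := mu1_taylor hy.1 hy.2
      _ = _ := by ring
  have hpol : (fun y : ℝ => (1 + p * y ^ 2 + q * y ^ 4) - (1 + p * y ^ 2 + q * (y ^ 2) ^ 2))
      =O[𝓝[>] 0] fun y => (y ^ 2) ^ 3 := by
    refine (isBigO_zero _ _).congr_left fun y => ?_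
    ring
  have hT : (fun y : ℝ => mu1 y / (kap * y) * (1 + p * y ^ 2 + q * y ^ 4)
      - (1 + (p - 1 / 12) * y ^ 2 + (q - p / 12 + 1 / 160) * (y ^ 2) ^ 2))
      =O[𝓝[>] 0] fun y => (y ^ 2) ^ 3 := by
    refine (isBigO_mul_expansion tendsto_sq_zero hm hpol).congr_left fun y => ?_
    ring
  have hTn := isBigO_pow_expansion tendsto_sq_zero hT n
  have hrest : (fun y : ℝ => ((4 - del n) / 2 + eps n) * q * y ^ 6) =O[𝓝[>] 0]
      fun y => (y ^ 2) ^ 3 := by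
    refine ((isBigO_refl (fun y : ℝ => (y ^ 2) ^ 3) (𝓝[>] 0)).const_mul_left
      (((4 - del n) / 2 + eps n) * q)).congr_left fun y => ?_
    ring
  obtain ⟨C, hC0, hC⟩ := (hrest.sub (hTn.const_mul_left (del n * (del n + 1)))).exists_pos
  refine ⟨lam n * C, by positivity, ?_⟩
  filter_upwards [self_mem_nhdsWithin, hC.bound] with y (hy : 0 < y) hCy
  have hX : 0 < y ^ (-del n) := Real.rpow_pos_of_pos hy _
  have hpow : (2 * mu1 y * approx n y) ^ n = lam n * y ^ (-del n) / y ^ 2 *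
      (del n * (del n + 1) * (mu1 y / (kap * y) * (1 + p * y ^ 2 + q * y ^ 4)) ^ n) := by
    have h2 : 2 * mu1 y * approx n y = (2 * kap) * lam n * (y * y ^ (-del n)) *
        (mu1 y / (kap * y) * (1 + p * y ^ 2 + q * y ^ 4)) := by
      rw [approx_eq hy, ← hp, ← hq]; field_simp
    rw [h2, mul_pow, mul_pow, mul_pow (2 * kap), lam_pow' hn, mul_rpow_neg_del_pow hn hy]
    ring
  have hlin : approxDeriv₂ n y + y / 2 * approxDeriv n y + eps n * approx n y =
      lam n * y ^ (-del n) / y ^ 2 * (del n * (del n + 1) * (1 + n * (p - 1 / 12) * y ^ 2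
        + (n * (q - p / 12 + 1 / 160) + n * (n - 1) / 2 * (p - 1 / 12) ^ 2) * (y ^ 2) ^ 2)
        + ((4 - del n) / 2 + eps n) * q * y ^ 6) := by
    have h3 : approxDeriv₂ n y + y / 2 * approxDeriv n y + eps n * approx n y =
        lam n * y ^ (-del n) / y ^ 2 * (del n * (del n + 1)
          + ((2 - del n) * (1 - del n) * p - del n / 2 + eps n) * y ^ 2
          + ((4 - del n) * (3 - del n) * q + (2 - del n) / 2 * p + eps n * p) * y ^ 4
          + ((4 - del n) / 2 + eps n) * q * y ^ 6) := by
      rw [approxDeriv₂, approxDeriv, approx, rpow_two_sub hy, rpow_four_sub hy]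
      field_simp
      ring
    rw [h3, h0, h1]
    ring
  rw [hpow, hlin, ← mul_sub, abs_mul, abs_of_pos (by positivity)]
  rw [Real.norm_eq_abs, Real.norm_of_nonneg (by positivity)] at hCy
  calc _ = lam n * y ^ (-del n) / y ^ 2 * |((4 - del n) / 2 + eps n) * q * y ^ 6
        - del n * (del n + 1) * ((mu1 y / (kap * y) * (1 + p * y ^ 2 + q * y ^ 4)) ^ n
          - (1 + n * (p - 1 / 12) * y ^ 2
        + (n * (q - p / 12 + 1 / 160) + n * (n - 1) / 2 * (p - 1 / 12) ^ 2) * (y ^ 2) ^ 2))| := by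
        congr 2; ring
    _ ≤ lam n * y ^ (-del n) / y ^ 2 * (C * (y ^ 2) ^ 3) := by gcongr
    _ = _ := by field_simp

/-- Comparison near zero: a function which is `o(y ^ (-δ))` and satisfies a linear equation with a
potential `c` larger than `θ (θ - 1) / y²` and with right-hand side at least `-C y ^ (θ - 2)` is
at most `O(y ^ θ)`. -/
theorem le_rpow_of_linear_equation (hn : 4 ≤ n) {y₀ C γ θ : ℝ} {d d' d'' c : ℝ → ℝ} (hy₀ : 0 < y₀)
    (hγ : 0 < γ)
    (h1 : ∀ y ∈ Set.Ioc 0 y₀, HasDerivAt d (d' y) y)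
    (h2 : ∀ y ∈ Set.Ioc 0 y₀, HasDerivAt d' (d'' y) y)
    (heq : ∀ y ∈ Set.Ioc 0 y₀,
      -(C * (y ^ θ / y ^ 2)) ≤ d'' y + y / 2 * d' y + eps n * d y - c y * d y)
    (hcθ : ∀ y ∈ Set.Ioc 0 y₀, θ * (θ - 1) + (θ / 2 + eps n) * y ^ 2 + γ ≤ c y * y ^ 2)
    (hcδ : ∀ y ∈ Set.Ioc 0 y₀, del n * (del n + 1) ≤ c y * y ^ 2)
    (hcε : ∀ y ∈ Set.Ioc 0 y₀, eps n < c y)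
    (hd : Tendsto (fun y => d y * y ^ del n) (𝓝[>] 0) (𝓝 0)) :
    ∃ K, ∀ y ∈ Set.Ioc 0 y₀, d y ≤ K * y ^ θ := by
  set K : ℝ := |C| / γ + |d y₀| / y₀ ^ θ with hK
  have hY₀ : 0 < y₀ ^ θ := Real.rpow_pos_of_pos hy₀ _
  have hK0 : 0 ≤ K := by positivity
  have hδ := one_lt_del hn
  have hε := eps_le hn
  refine ⟨K, fun y hy => le_of_forall_pos_le_add fun e he => ?_⟩
  have hX : 0 < y ^ (-del n) := Real.rpow_pos_of_pos hy.1 _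
  -- The singular part of the barrier, `η y ^ (-δ)`, is eventually sent to zero.
  set η : ℝ := e / y ^ (-del n) with hη
  have hη0 : 0 < η := by positivity
  have key := nonpos_of_strict_subsolution_of_ends (U := Set.Ioc 0 y₀) (b := fun y => y / 2)
    (d := fun x => d x - (K * x ^ θ + η * x ^ (-del n)))
    (d' := fun x => d' x - (K * θ * x ^ θ / x + η * -del n * x ^ (-del n) / x))
    (d'' := fun x => d'' x - (K * θ * (θ - 1) * x ^ θ / x ^ 2
      + η * -del n * (-del n - 1) * x ^ (-del n) / x ^ 2))
    (fun x hx => (h1 x hx).sub ((hasDerivAt_const_mul_rpow _ _ hx.1).add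
      (hasDerivAt_const_mul_rpow _ _ hx.1)))
    (fun x hx => (h2 x hx).sub ((hasDerivAt_const_mul_rpow_div _ _ hx.1).add
      (hasDerivAt_const_mul_rpow_div _ _ hx.1)))
    ?_ ?_ y hy
  · have : η * y ^ (-del n) = e := by rw [hη]; field_simp
    linarith
  · intro x hx hv
    have hx0 := hx.1
    have hXx : 0 < x ^ (-del n) := Real.rpow_pos_of_pos hx0 _
    have hYx : 0 < x ^ θ := Real.rpow_pos_of_pos hx0 _
    have e1 := heq x hx
    have e2 := hcθ x hx
    have e3 := hcδ x hx
    have e4 := hcε x hx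
    set X := x ^ (-del n) with hXd
    set Y := x ^ θ with hYd
    have f1 : 0 < (c x - eps n) * (d x - (K * Y + η * X)) := mul_pos (by linarith) hv
    have f2 : C * (Y / x ^ 2) ≤ K * (Y / x ^ 2) * γ := by
      have : C ≤ K * γ := by
        have : K * γ = |C| + |d y₀| / y₀ ^ θ * γ := by rw [hK]; field_simp
        have : 0 ≤ |d y₀| / y₀ ^ θ * γ := by positivity
        linarith [le_abs_self C]
      have := mul_le_mul_of_nonneg_right this (by positivity : 0 ≤ Y / x ^ 2)
      linarith
    have f3 : 0 ≤ K * (Y / x ^ 2) *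
        (c x * x ^ 2 - (θ * (θ - 1) + (θ / 2 + eps n) * x ^ 2 + γ)) :=
      mul_nonneg (by positivity) (by linarith)
    have f4 : 0 ≤ η * (X / x ^ 2) *
        (c x * x ^ 2 - del n * (del n + 1) + (del n / 2 - eps n) * x ^ 2) := by
      refine mul_nonneg (by positivity) ?_
      have : 0 ≤ (del n / 2 - eps n) * x ^ 2 := mul_nonneg (by linarith) (by positivity)
      linarith
    have f5 : d'' x - (K * θ * (θ - 1) * Y / x ^ 2 + η * -del n * (-del n - 1) * X / x ^ 2)
        + x / 2 * (d' x - (K * θ * Y / x + η * -del n * X / x))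
        = (d'' x + x / 2 * d' x + eps n * d x - c x * d x)
          + (c x - eps n) * (d x - (K * Y + η * X)) + K * (Y / x ^ 2) * γ
          + K * (Y / x ^ 2) * (c x * x ^ 2 - (θ * (θ - 1) + (θ / 2 + eps n) * x ^ 2 + γ))
          + η * (X / x ^ 2) *
            (c x * x ^ 2 - del n * (del n + 1) + (del n / 2 - eps n) * x ^ 2) := by
      field_simp
      ring
    rw [f5]
    linarith
  · intro x hx a ha
    have hev : ∀ᶠ z in 𝓝[>] (0 : ℝ), d z * z ^ del n < η ∧ z < x :=
      (hd.eventually_lt_const hη0).and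
        (Filter.mem_of_superset (Ioo_mem_nhdsGT hx.1) fun z hz => hz.2)
    obtain ⟨z, ⟨hz1, hz2⟩, hz0 : 0 < z⟩ := (hev.and self_mem_nhdsWithin).exists
    refine ⟨z, y₀, hz2.le, hx.2, fun t ht => ⟨hz0.trans_le ht.1, ht.2⟩, ?_, ?_⟩
    · have hZ : 0 < z ^ (-del n) := Real.rpow_pos_of_pos hz0 _
      have h3 : z ^ del n * z ^ (-del n) = 1 := by
        rw [← Real.rpow_add hz0, add_neg_cancel, Real.rpow_zero]
      have h4 : d z ≤ η * z ^ (-del n) := by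
        have := mul_le_mul_of_nonneg_right hz1.le hZ.le
        rwa [mul_assoc, h3, mul_one] at this
      have : 0 ≤ K * z ^ θ := mul_nonneg hK0 (Real.rpow_pos_of_pos hz0 _).le
      linarith
    · have h5 : 0 ≤ η * y₀ ^ (-del n) := mul_nonneg hη0.le (Real.rpow_pos_of_pos hy₀ _).le
      have h6 : K * y₀ ^ θ = |C| / γ * y₀ ^ θ + |d y₀| := by rw [hK]; field_simp
      have h7 : 0 ≤ |C| / γ * y₀ ^ θ := by positivity
      linarith [le_abs_self (d y₀)]

end NearZero

section NearZeroSolution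

variable {n : ℕ}

theorem tendsto_approx_mul_rpow :
    Tendsto (fun y => approx n y * y ^ del n) (𝓝[>] 0) (𝓝 (lam n)) := by
  have h : Tendsto (fun y : ℝ => lam n * (1 + relLam0 n * y ^ 2 + relLam1 n * y ^ 4)) (𝓝[>] 0)
      (𝓝 (lam n)) := by
    have : Continuous fun y : ℝ => lam n * (1 + relLam0 n * y ^ 2 + relLam1 n * y ^ 4) := by
      fun_prop
    simpa using (this.tendsto 0).mono_left (nhdsWithin_le_nhds (s := Set.Ioi 0))
  refine h.congr' ?_
  filter_upwards [self_mem_nhdsWithin] with y (hy : 0 < y)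
  have h1 : y ^ (-del n) * y ^ del n = 1 := by
    rw [← Real.rpow_add hy, neg_add_cancel, Real.rpow_zero]
  rw [approx_eq hy]
  calc _ = lam n * (1 + relLam0 n * y ^ 2 + relLam1 n * y ^ 4) * 1 := by ring
    _ = _ := by rw [← h1]; ring

/-- The difference quotient `((2 μ₁ μ) ^ n - (2 μ₁ ν) ^ n) / (μ - ν)`, as a polynomial. -/
def potential (n : ℕ) (μ ν : ℝ → ℝ) (y : ℝ) : ℝ :=
  (2 * mu1 y) ^ n * ∑ i ∈ Finset.range n, μ y ^ i * ν y ^ (n - 1 - i)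

theorem potential_mul (μ ν : ℝ → ℝ) (y : ℝ) :
    potential n μ ν y * (μ y - ν y) = (2 * mu1 y * μ y) ^ n - (2 * mu1 y * ν y) ^ n := by
  rw [potential, mul_assoc, geom_sum₂_mul, mul_sub, ← mul_pow, ← mul_pow]

theorem tendsto_potential_mul_sq (hn : 4 ≤ n) {μ ν : ℝ → ℝ}
    (hμ : Tendsto (fun y => μ y * y ^ del n) (𝓝[>] 0) (𝓝 (lam n)))
    (hν : Tendsto (fun y => ν y * y ^ del n) (𝓝[>] 0) (𝓝 (lam n))) :
    Tendsto (fun y => potential n μ ν y * y ^ 2) (𝓝[>] 0) (𝓝 (n * (del n * (del n + 1)))) := by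
  have hk := kap_pos
  have h1 : Tendsto (fun y => (2 * kap * (mu1 y / (kap * y))) ^ n *
      ∑ i ∈ Finset.range n, (μ y * y ^ del n) ^ i * (ν y * y ^ del n) ^ (n - 1 - i)) (𝓝[>] 0)
      (𝓝 ((2 * kap * 1) ^ n * ∑ i ∈ Finset.range n, lam n ^ i * lam n ^ (n - 1 - i))) :=
    ((tendsto_mu1_div.const_mul _).pow n).mul
      (tendsto_finsetSum _ fun i _ => (hμ.pow i).mul (hν.pow _))
  have h2 : (2 * kap * 1) ^ n * ∑ i ∈ Finset.range n, lam n ^ i * lam n ^ (n - 1 - i)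
      = n * (del n * (del n + 1)) := by
    have : ∀ i ∈ Finset.range n, lam n ^ i * lam n ^ (n - 1 - i) = lam n ^ (n - 1) := by
      intro i hi
      have := Finset.mem_range.1 hi
      rw [← pow_add]
      congr 1
      omega
    rw [Finset.sum_congr rfl this, Finset.sum_const, Finset.card_range, nsmul_eq_mul,
      ← lam_pow hn]
    ring
  rw [h2] at h1
  refine h1.congr' ?_
  filter_upwards [self_mem_nhdsWithin] with y (hy : 0 < y)
  have hX : 0 < y ^ del n := Real.rpow_pos_of_pos hy _
  have h3 : ∀ i ∈ Finset.range n, (μ y * y ^ del n) ^ i * (ν y * y ^ del n) ^ (n - 1 - i)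
      = μ y ^ i * ν y ^ (n - 1 - i) * (y ^ del n) ^ (n - 1) := by
    intro i hi
    have hi := Finset.mem_range.1 hi
    have : (y ^ del n) ^ (n - 1) = (y ^ del n) ^ i * (y ^ del n) ^ (n - 1 - i) := by
      rw [← pow_add]; congr 1; omega
    rw [this]; ring
  rw [Finset.sum_congr rfl h3, ← Finset.sum_mul, potential]
  have h4 : (y ^ del n) ^ (n - 1) = y ^ n * y ^ 2 := by
    have h := cast_mul_del hn
    rw [← Real.rpow_natCast, ← Real.rpow_mul hy.le, ← Real.rpow_natCast y n,
      ← Real.rpow_natCast y 2, ← Real.rpow_add hy, Nat.cast_sub (by omega)]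
    congr 1
    push_cast
    linarith
  have h5 : (2 * kap * (mu1 y / (kap * y))) ^ n * y ^ n = (2 * mu1 y) ^ n := by
    rw [← mul_pow]; congr 1; field_simp
  rw [h4, ← h5]
  ring

/-- Every solution agrees with the three-term expansion up to `O(y ^ (5 - δ))`. -/
theorem IsPositiveSolution.abs_sub_approx_le (hn : 4 ≤ n) {μ : ℝ → ℝ}
    (h : IsPositiveSolution n μ) : ∃ y₀ K : ℝ, 0 < y₀ ∧
      ∀ y ∈ Set.Ioc 0 y₀, |μ y - approx n y| ≤ K * y ^ (5 - del n) := by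
  obtain ⟨C, hC0, hC⟩ := approx_residual hn
  have hδ := one_lt_del hn
  have hδ2 := del_le_two hn
  have hε := eps_pos hn
  have hε' := eps_le hn
  have hb := del_mul_pos hn
  have hn4 := cast_ge_four hn
  set c := potential n μ (approx n) with hcdef
  have hclim : Tendsto (fun y => c y * y ^ 2) (𝓝[>] 0) (𝓝 (n * (del n * (del n + 1)))) :=
    tendsto_potential_mul_sq hn h.at_zero tendsto_approx_mul_rpow
  set θ : ℝ := 5 - del n with hθ
  have hgap := relLam1_den_pos hn
  set γ : ℝ := (n * (del n * (del n + 1)) - (5 - del n) * (4 - del n)) / 2 with hγ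
  have hγ0 : 0 < γ := by positivity
  have e1 : ∀ᶠ y in 𝓝[>] (0 : ℝ), γ < c y * y ^ 2 - (θ * (θ - 1) + (θ / 2 + eps n) * y ^ 2) := by
    have h1 : Tendsto (fun y : ℝ => c y * y ^ 2 - (θ * (θ - 1) + (θ / 2 + eps n) * y ^ 2)) (𝓝[>] 0)
        (𝓝 (n * (del n * (del n + 1)) - (θ * (θ - 1) + (θ / 2 + eps n) * 0))) :=
      hclim.sub (tendsto_const_nhds.add (tendsto_sq_zero.const_mul _))
    refine h1.eventually_const_lt ?_
    rw [hθ]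
    linarith
  have e2 : ∀ᶠ y in 𝓝[>] (0 : ℝ), del n * (del n + 1) < c y * y ^ 2 :=
    hclim.eventually_const_lt (by nlinarith)
  have e3 : ∀ᶠ y in 𝓝[>] (0 : ℝ), y < 1 :=
    Filter.mem_of_superset (Ioo_mem_nhdsGT one_pos) fun z hz => hz.2
  obtain ⟨y₀, hy₀, hev⟩ := (mem_nhdsGT_iff_exists_Ioc_subset).1
    (((hC.and e1).and e2).and e3)
  replace hy₀ : 0 < y₀ := hy₀
  have hcε : ∀ y ∈ Set.Ioc 0 y₀, eps n < c y := by
    intro y hy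
    have h1 : del n * (del n + 1) < c y * y ^ 2 := (hev hy).1.2
    have h2 : y < 1 := (hev hy).2
    have hy0 := hy.1
    have h3 : y ^ 2 < 1 := by nlinarith
    by_contra! hle
    have h4 : c y * y ^ 2 ≤ eps n * y ^ 2 := mul_le_mul_of_nonneg_right hle (by positivity)
    nlinarith
  have hθC : ∀ y ∈ Set.Ioc 0 y₀, C * (y ^ (-del n) * y ^ 4) ≤ C * (y ^ θ / y ^ 2) := by
    intro y hy
    have h2 : y < 1 := (hev hy).2
    have hy0 := hy.1
    have hX : 0 < y ^ (-del n) := Real.rpow_pos_of_pos hy0 _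
    have h3 : y ^ θ / y ^ 2 = y ^ (-del n) * y ^ 3 := by
      have : y ^ θ = y ^ (-del n) * y ^ 5 := by
        rw [hθ, sub_eq_add_neg, add_comm, Real.rpow_add hy0]
        norm_cast
      rw [this]
      field_simp
    rw [h3]
    have : y ^ 4 ≤ y ^ 3 := pow_le_pow_of_le_one hy0.le h2.le (by norm_num)
    gcongr
  have hlin : ∀ y : ℝ, 0 < y → (deriv (deriv μ) y - approxDeriv₂ n y)
      + y / 2 * (deriv μ y - approxDeriv n y) + eps n * (μ y - approx n y)
      - c y * (μ y - approx n y) = -(approxDeriv₂ n y + y / 2 * approxDeriv n y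
        + eps n * approx n y - (2 * mu1 y * approx n y) ^ n) := by
    intro y hy
    have h1 := h.ode y hy
    have h2 := potential_mul (n := n) μ (approx n) y
    rw [← hcdef] at h2
    rw [h2, ← h1]
    ring
  have hd0 : Tendsto (fun y => (μ y - approx n y) * y ^ del n) (𝓝[>] 0) (𝓝 0) := by
    have := h.at_zero.sub (tendsto_approx_mul_rpow (n := n))
    rw [sub_self] at this
    exact this.congr fun y => by ring
  have hcθ : ∀ y ∈ Set.Ioc 0 y₀, θ * (θ - 1) + (θ / 2 + eps n) * y ^ 2 + γ ≤ c y * y ^ 2 := by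
    intro y hy
    have : γ < c y * y ^ 2 - (θ * (θ - 1) + (θ / 2 + eps n) * y ^ 2) := (hev hy).1.1.2
    linarith
  have hcδ : ∀ y ∈ Set.Ioc 0 y₀, del n * (del n + 1) ≤ c y * y ^ 2 := fun y hy =>
    le_of_lt (hev hy).1.2
  have hres : ∀ y ∈ Set.Ioc 0 y₀, |approxDeriv₂ n y + y / 2 * approxDeriv n y
        + eps n * approx n y - (2 * mu1 y * approx n y) ^ n| ≤ C * (y ^ θ / y ^ 2) := fun y hy =>
    (hev hy).1.1.1.trans (hθC y hy)
  obtain ⟨K₁, hK₁⟩ := le_rpow_of_linear_equation hn (C := C) (c := c) hy₀ hγ0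
    (fun y hy => (h.hasDerivAt hy.1).sub (hasDerivAt_approx hy.1))
    (fun y hy => (h.hasDerivAt_deriv hy.1).sub (hasDerivAt_approxDeriv hy.1))
    (fun y hy => by
      have h1 := (abs_le.1 (hres y hy)).2
      have h2 := hlin y hy.1
      simp only [Pi.sub_apply]
      linarith) hcθ hcδ hcε hd0
  obtain ⟨K₂, hK₂⟩ := le_rpow_of_linear_equation hn (C := C) (c := c) hy₀ hγ0
    (fun y hy => (hasDerivAt_approx (n := n) hy.1).sub (h.hasDerivAt hy.1))
    (fun y hy => (hasDerivAt_approxDeriv hy.1).sub (h.hasDerivAt_deriv hy.1))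
    (fun y hy => by
      have h1 := (abs_le.1 (hres y hy)).1
      have h2 := hlin y hy.1
      simp only [Pi.sub_apply]
      linarith) hcθ hcδ hcε (by
        have := hd0.neg
        rw [neg_zero] at this
        exact this.congr fun y => by simp only [Pi.sub_apply]; ring)
  refine ⟨y₀, max K₁ K₂, hy₀, fun y hy => ?_⟩
  have hY : 0 ≤ y ^ θ := (Real.rpow_pos_of_pos hy.1 _).le
  have h1 := hK₁ y hy
  have h2 := hK₂ y hy
  simp only [Pi.sub_apply] at h1 h2
  have h3 := mul_le_mul_of_nonneg_right (le_max_left K₁ K₂) hY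
  have h4 := mul_le_mul_of_nonneg_right (le_max_right K₁ K₂) hY
  rw [abs_le]
  constructor <;> linarith

theorem IsPositiveSolution.hasExpansionNearZero (hn : 4 ≤ n) {μ : ℝ → ℝ}
    (h : IsPositiveSolution n μ) :
    HasExpansionNearZero μ ![lam n, lam0 n, lam n * relLam1 n]
      ![-del n, 2 - del n, 4 - del n] := by
  have hl := lam_pos hn
  obtain ⟨y₀, K, hy₀, hK⟩ := h.abs_sub_approx_le hn
  refine ⟨?_, ?_⟩
  · intro i j hij
    fin_cases i <;> fin_cases j <;> simp at hij ⊢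
    linarith
  · have hlim : Tendsto (fun y : ℝ => K * y) (𝓝[>] 0) (𝓝 0) := by
      have : Continuous fun y : ℝ => K * y := by fun_prop
      simpa using (this.tendsto 0).mono_left (nhdsWithin_le_nhds (s := Set.Ioi 0))
    refine squeeze_zero' ?_ ?_ hlim
    · filter_upwards [self_mem_nhdsWithin] with y (hy : 0 < y)
      positivity
    · filter_upwards [Ioc_mem_nhdsGT hy₀] with y hy
      have hy0 := hy.1
      have hZ : 0 < y ^ (4 - del n) := Real.rpow_pos_of_pos hy0 _
      have h1 : ∑ i : Fin 3, ![lam n, lam0 n, lam n * relLam1 n] i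
          * y ^ ![-del n, 2 - del n, 4 - del n] i = approx n y := by
        rw [Fin.sum_univ_three]
        have : lam n * relLam0 n = lam0 n := by rw [relLam0]; field_simp
        rw [approx, this]
        rfl
      have h2 : y ^ (5 - del n) = y * y ^ (4 - del n) := by
        rw [show 5 - del n = 1 + (4 - del n) by ring, Real.rpow_add hy0, Real.rpow_one]
      have h3 := hK y hy
      rw [h2] at h3
      rw [h1]
      change 1 / y ^ (4 - del n) * |μ y - approx n y| ≤ K * y
      rw [one_div_mul_eq_div, div_le_iff₀ hZ]
      linarith

end NearZeroSolution

/-! ### The behaviour at infinity -/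

section NearInfinity

variable {n : ℕ}

/-- The growing barrier `exp (y² / 4) (y ^ (-2 ε) + 2 y ^ (-2 ε - 2))` is a supersolution of the
linear equation for `y ≥ 5`. -/
theorem growing_barrier (hn : 4 ≤ n) : ∃ G G' G'' : ℝ → ℝ, ∀ y, 5 ≤ y →
    HasDerivAt G (G' y) y ∧ HasDerivAt G' (G'' y) y ∧
    G'' y - y / 2 * G' y ≤ rate n * G y ∧
    Real.exp (y ^ 2 / 4) * y ^ (-(2 * eps n)) ≤ G y := by
  set s : ℝ := -(2 * eps n) with hs
  have hε := eps_pos hn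
  have hε' := eps_le hn
  set h : ℝ → ℝ := fun y => 1 * y ^ s + 2 * y ^ (s - 2) with hh
  set h' : ℝ → ℝ := fun y => 1 * s * y ^ s / y + 2 * (s - 2) * y ^ (s - 2) / y with hh'
  set h'' : ℝ → ℝ := fun y => 1 * s * (s - 1) * y ^ s / y ^ 2
    + 2 * (s - 2) * (s - 2 - 1) * y ^ (s - 2) / y ^ 2 with hh''
  have d1 : ∀ y, 0 < y → HasDerivAt h (h' y) y := fun y hy =>
    (hasDerivAt_const_mul_rpow _ _ hy).add (hasDerivAt_const_mul_rpow _ _ hy)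
  have d2 : ∀ y, 0 < y → HasDerivAt h' (h'' y) y := fun y hy =>
    (hasDerivAt_const_mul_rpow_div _ _ hy).add (hasDerivAt_const_mul_rpow_div _ _ hy)
  have hid : ∀ y, HasDerivAt (fun x : ℝ => x / 2) (1 / 2) y := fun y =>
    (hasDerivAt_id y).div_const 2
  refine ⟨fun y => Real.exp (y ^ 2 / 4) * h y, fun y => Real.exp (y ^ 2 / 4) * (h' y + y / 2 * h y),
    fun y => Real.exp (y ^ 2 / 4) * (h'' y + y * h' y + (1 / 2 + y ^ 2 / 4) * h y), fun y hy5 => ?_⟩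
  have hy : 0 < y := by linarith
  have he := hasDerivAt_exp_sq_div y
  have hY : 0 < y ^ s := Real.rpow_pos_of_pos hy _
  have hY2 : y ^ (s - 2) = y ^ s / y ^ 2 := by rw [Real.rpow_sub hy, Real.rpow_two]
  refine ⟨?_, ?_, ?_, ?_⟩
  · convert! he.mul (d1 y hy) using 1
    ring
  · convert! he.mul ((d2 y hy).add ((hid y).mul (d1 y hy))) using 1
    simp only [Pi.add_apply, Pi.mul_apply]
    ring
  · have h1 : h'' y + y / 2 * h' y + eps n * h y ≤ 0 := by
      have h2 : h'' y + y / 2 * h' y + eps n * h y = y ^ s / y ^ 2 *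
          (2 * eps n * (2 * eps n + 1) - 2 + 2 * (2 * eps n + 2) * (2 * eps n + 3) / y ^ 2) := by
        simp only [hh, hh', hh'', hY2]
        rw [hs]
        field_simp
        ring
      rw [h2]
      refine mul_nonpos_of_nonneg_of_nonpos (by positivity) ?_
      have h3 : 2 * (2 * eps n + 2) * (2 * eps n + 3) / y ^ 2 ≤ 22 / 25 := by
        rw [div_le_iff₀ (by positivity)]
        nlinarith
      nlinarith
    have h4 := mul_nonpos_of_nonneg_of_nonpos (Real.exp_pos (y ^ 2 / 4)).le h1
    rw [rate]
    linarith
  · have : 0 ≤ y ^ (s - 2) := (Real.rpow_pos_of_pos hy _).le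
    refine mul_le_mul_of_nonneg_left ?_ (Real.exp_pos _).le
    simp only [hh]
    linarith

/-- Every solution decays at least like `exp (-y² / 4) y ^ (-(1 - 2 ε))`. -/
theorem IsPositiveSolution.exp_mul_le (hn : 4 ≤ n) {μ : ℝ → ℝ} (h : IsPositiveSolution n μ) :
    ∃ K, 0 < K ∧ ∀ y, 5 ≤ y → Real.exp (y ^ 2 / 4) * μ y ≤ K * y ^ (-(2 * rate n)) := by
  obtain ⟨G, G', G'', hG⟩ := growing_barrier hn
  have ha := rate_pos hn
  have ha2 : rate n ≤ 1 / 2 := by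
    have := eps_pos hn
    rw [rate]; linarith
  set s : ℝ := -(2 * rate n) with hs
  set k : ℝ := 2 * rate n * (2 * rate n + 1) with hk
  have hk0 : 0 < k := by positivity
  have hk2 : k ≤ 2 := by nlinarith
  -- `S = y ^ s - k y ^ (s - 2)` is a decaying supersolution of the linear equation.
  set S : ℝ → ℝ := fun y => 1 * y ^ s + -k * y ^ (s - 2) with hS
  set S' : ℝ → ℝ := fun y => 1 * s * y ^ s / y + -k * (s - 2) * y ^ (s - 2) / y with hS'
  set S'' : ℝ → ℝ := fun y => 1 * s * (s - 1) * y ^ s / y ^ 2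
    + -k * (s - 2) * (s - 2 - 1) * y ^ (s - 2) / y ^ 2 with hS''
  have d1 : ∀ y, 0 < y → HasDerivAt S (S' y) y := fun y hy =>
    (hasDerivAt_const_mul_rpow _ _ hy).add (hasDerivAt_const_mul_rpow _ _ hy)
  have d2 : ∀ y, 0 < y → HasDerivAt S' (S'' y) y := fun y hy =>
    (hasDerivAt_const_mul_rpow_div _ _ hy).add (hasDerivAt_const_mul_rpow_div _ _ hy)
  have hY2 : ∀ y : ℝ, 0 < y → y ^ (s - 2) = y ^ s / y ^ 2 := fun y hy => by
    rw [Real.rpow_sub hy, Real.rpow_two]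
  have hSL : ∀ y, 0 < y → S'' y - y / 2 * S' y ≤ rate n * S y := by
    intro y hy
    have hY : 0 < y ^ s := Real.rpow_pos_of_pos hy _
    have h2 : S'' y - y / 2 * S' y - rate n * S y =
        -(k * (2 * rate n + 2) * (2 * rate n + 3) * (y ^ s / y ^ 4)) := by
      simp only [hS, hS', hS'', hY2 y hy]
      generalize y ^ s = Y
      rw [hs, hk]
      field_simp
      ring
    have : 0 ≤ k * (2 * rate n + 2) * (2 * rate n + 3) * (y ^ s / y ^ 4) := by positivity
    linarith
  have hSpos : ∀ y, 5 ≤ y → 0 < S y ∧ S y ≤ y ^ s := by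
    intro y hy5
    have hy : 0 < y := by linarith
    have hY : 0 < y ^ s := Real.rpow_pos_of_pos hy _
    have h1 : S y = y ^ s * (1 - k / y ^ 2) := by
      simp only [hS, hY2 y hy]; ring
    have h2 : k / y ^ 2 < 1 := by
      rw [div_lt_one (by positivity)]
      nlinarith
    have h3 : 0 ≤ k / y ^ 2 := by positivity
    rw [h1]
    exact ⟨mul_pos hY (by linarith), mul_le_of_le_one_right hY.le (by linarith)⟩
  set u : ℝ → ℝ := fun y => Real.exp (y ^ 2 / 4) * μ y with hu
  have hupos : ∀ y, 0 < y → 0 < u y := fun y hy => mul_pos (Real.exp_pos _) (h.pos y hy)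
  set K : ℝ := u 5 / S 5 with hK
  have hS5 := (hSpos 5 le_rfl).1
  have hK0 : 0 < K := div_pos (hupos 5 (by norm_num)) hS5
  refine ⟨K, hK0, fun y hy => ?_⟩
  suffices hmain : u y ≤ K * S y from
    hmain.trans (mul_le_mul_of_nonneg_left (hSpos y hy).2 hK0.le)
  have hGpos : ∀ x, 5 ≤ x → 0 < G x := fun x hx =>
    lt_of_lt_of_le (mul_pos (Real.exp_pos _) (Real.rpow_pos_of_pos (by linarith) _)) (hG x hx).2.2.2
  refine le_of_forall_pos_le_add fun e he => ?_
  set η : ℝ := e / G y with hη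
  have hη0 : 0 < η := div_pos he (hGpos y hy)
  have key := nonpos_of_strict_subsolution_of_ends (U := Set.Ici 5) (b := fun y => -(y / 2))
    (d := fun x => u x - (K * S x + η * G x))
    (d' := fun x => Real.exp (x ^ 2 / 4) * (deriv μ x + x / 2 * μ x) - (K * S' x + η * G' x))
    (d'' := fun x => x / 2 * (Real.exp (x ^ 2 / 4) * (deriv μ x + x / 2 * μ x))
        + force n x (u x) - (K * S'' x + η * G'' x))
    (fun x hx => (h.exp_mul (by linarith [Set.mem_Ici.1 hx])).1.sub
      (((d1 x (by linarith [Set.mem_Ici.1 hx])).const_mul K).add ((hG x hx).1.const_mul η)))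
    (fun x hx => (h.exp_mul (by linarith [Set.mem_Ici.1 hx])).2.sub
      (((d2 x (by linarith [Set.mem_Ici.1 hx])).const_mul K).add ((hG x hx).2.1.const_mul η)))
    ?_ ?_ y hy
  · have : η * G y = e := by
      rw [hη]
      exact div_mul_cancel₀ _ (hGpos y hy).ne'
    linarith
  · intro x hx hv
    have hx5 : (5 : ℝ) ≤ x := hx
    have hx0 : 0 < x := by linarith
    have f1 := mul_le_mul_of_nonneg_left (hSL x hx0) hK0.le
    have f2 := mul_le_mul_of_nonneg_left (hG x hx5).2.2.1 hη0.le
    have f3 : 0 ≤ coef n x * u x ^ n :=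
      mul_nonneg (coef_pos hx0).le (pow_nonneg (hupos x hx0).le _)
    have f4 := mul_pos ha hv
    simp only [force]
    linarith
  · intro x hx a ha0
    have hx5 : (5 : ℝ) ≤ x := hx
    obtain ⟨z, hz1, hz2⟩ := ((h.at_infinity.eventually_lt_const hη0).and
      (eventually_ge_atTop x)).exists
    have hz5 : 5 ≤ z := hx5.trans hz2
    have hz0 : 0 < z := by linarith
    refine ⟨5, z, hx5, hz2, fun t ht => ht.1, ?_, ?_⟩
    · have h1 : K * S 5 = u 5 := by
        rw [hK]
        exact div_mul_cancel₀ _ hS5.ne'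
      have h2 := mul_pos hη0 (hGpos 5 le_rfl)
      linarith
    · have h1 : 0 < z ^ (-(2 * eps n)) := Real.rpow_pos_of_pos hz0 _
      have h2 : z ^ (2 * eps n) * z ^ (-(2 * eps n)) = 1 := by
        rw [← Real.rpow_add hz0, add_neg_cancel, Real.rpow_zero]
      have h3 : μ z ≤ η * z ^ (-(2 * eps n)) := by
        have := mul_le_mul_of_nonneg_right hz1.le h1.le
        rwa [mul_assoc, h2, mul_one] at this
      have h4 : u z ≤ η * G z := by
        have h5 := mul_le_mul_of_nonneg_left h3 (Real.exp_pos (z ^ 2 / 4)).le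
        have h6 := mul_le_mul_of_nonneg_left (hG z hz5).2.2.2 hη0.le
        linarith
      have := mul_pos hK0 (hSpos z hz5).1
      linarith

/-- The nonlinear term is eventually negligible against `u / y²`. -/
theorem eventually_coef_mul_pow_lt (hn : 4 ≤ n) {K k : ℝ} (hk : 0 < k) :
    ∀ᶠ y in atTop, coef n y * K ^ (n - 1) * y ^ 2 < k := by
  have hkap := kap_pos
  have h := (Real.tendsto_pow_mul_exp_neg_atTop_nhds_zero (n + 2)).const_mul
    ((2 * kap) ^ n * |K| ^ (n - 1))
  rw [mul_zero] at h
  filter_upwards [h.eventually_lt_const hk, eventually_ge_atTop 4] with y hy hy4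
  have hy0 : 0 < y := by linarith
  refine lt_of_le_of_lt ?_ hy
  have h1 : coef n y ≤ (2 * kap * y) ^ n * Real.exp (-y) := by
    have h2 : Real.exp (y ^ 2 / 4) * Real.exp (-(y ^ 2 / 4)) ^ n ≤ Real.exp (-y) := by
      rw [← Real.exp_nat_mul, ← Real.exp_add, Real.exp_le_exp]
      have := cast_ge_four hn
      nlinarith
    have h3 := mu1_le hy0.le
    have h4 := (mu1_pos hy0).le
    calc coef n y = (2 * mu1 y) ^ n * (Real.exp (y ^ 2 / 4) * Real.exp (-(y ^ 2 / 4)) ^ n) := by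
          rw [coef, mul_pow _ (Real.exp _)]; ring
      _ ≤ (2 * (kap * y)) ^ n * Real.exp (-y) := by gcongr
      _ = _ := by rw [mul_assoc 2]
  have h5 : K ^ (n - 1) ≤ |K| ^ (n - 1) := by
    rw [← abs_pow]; exact le_abs_self _
  have h6 := (coef_pos (n := n) hy0).le
  calc coef n y * K ^ (n - 1) * y ^ 2 ≤ coef n y * |K| ^ (n - 1) * y ^ 2 := by gcongr
    _ ≤ (2 * kap * y) ^ n * Real.exp (-y) * |K| ^ (n - 1) * y ^ 2 := by gcongr
    _ = _ := by rw [mul_pow, pow_add]; ring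

/-- A positive function whose derivative is the product of an antitone function and a function
which is at least `1` is increasing. -/
theorem monotoneOn_of_antitoneOn_factor {q W m : ℝ → ℝ} {M : ℝ}
    (hq : ∀ y ∈ Set.Ici M, HasDerivAt q (W y * m y) y) (hW : AntitoneOn W (Set.Ici M))
    (hm : ∀ y ∈ Set.Ici M, 1 ≤ m y) (hpos : ∀ y ∈ Set.Ici M, 0 < q y) :
    MonotoneOn q (Set.Ici M) := by
  have hcont : ContinuousOn q (Set.Ici M) := fun y hy => (hq y hy).continuousAt.continuousWithinAt
  have hW0 : ∀ y ∈ Set.Ici M, 0 ≤ W y := by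
    intro y hy
    by_contra! hneg
    -- Otherwise `q` would decrease at least linearly from `y` on, and reach negative values.
    set z : ℝ := y + q y / -W y with hz
    have hyz : y < z := by
      have : 0 < q y / -W y := div_pos (hpos y hy) (by linarith)
      linarith
    have hsub : Set.Icc y z ⊆ Set.Ici M := fun t ht => le_trans hy ht.1
    obtain ⟨x, hx, hx'⟩ := exists_hasDerivAt_eq_slope q (fun y => W y * m y) hyz
      (hcont.mono hsub) fun x hx => hq x (hsub (Set.Ioo_subset_Icc_self hx))
    have hxM := hsub (Set.Ioo_subset_Icc_self hx)
    have h1 : W x ≤ W y := hW hy hxM hx.1.le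
    have h2 : W x * m x ≤ W y := by nlinarith [hm x hxM]
    have hzM : z ∈ Set.Ici M := hsub ⟨hyz.le, le_rfl⟩
    rw [hx', div_le_iff₀ (by linarith)] at h2
    have h3 : W y * (z - y) = -q y := by
      rw [hz]
      have : W y ≠ 0 := hneg.ne
      field_simp
      ring
    linarith [hpos z hzM]
  refine monotoneOn_of_deriv_nonneg (convex_Ici M) hcont (fun y hy => ?_) fun y hy => ?_
  · rw [interior_Ici] at hy
    exact (hq y (Set.Ioi_subset_Ici_self hy)).differentiableAt.differentiableWithinAt
  · rw [interior_Ici] at hy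
    have hy' := Set.Ioi_subset_Ici_self hy
    rw [(hq y hy').deriv]
    exact mul_nonneg (hW0 y hy') (by linarith [hm y hy'])

/-- `exp (y² / 4) μ(y) y ^ (1 - 2 ε)` has a positive limit at infinity: it is eventually increasing,
since its derivative is a positive multiple of the Wronskian of `exp (y² / 4) μ` and the subsolution
`y ^ (-(1 - 2 ε))` of the linear equation. -/
theorem IsPositiveSolution.exists_tendsto_atTop (hn : 4 ≤ n) {μ : ℝ → ℝ}
    (h : IsPositiveSolution n μ) : ∃ C, 0 < C ∧
      Tendsto (fun y => Real.exp (y ^ 2 / 4) * μ y * y ^ (2 * rate n)) atTop (𝓝 C) := by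
  obtain ⟨K, hK0, hK⟩ := h.exp_mul_le hn
  have ha := rate_pos hn
  set k : ℝ := 2 * rate n * (2 * rate n + 1) with hk
  have hk0 : 0 < k := by positivity
  obtain ⟨M₀, hM₀⟩ := eventually_atTop.1 (eventually_coef_mul_pow_lt hn (K := K) hk0)
  set M : ℝ := max M₀ 5 with hM
  have hM5 : ∀ y ∈ Set.Ici M, (5 : ℝ) ≤ y := fun y hy => (le_max_right _ _).trans hy
  have hMM : ∀ y ∈ Set.Ici M, M₀ ≤ y := fun y hy => (le_max_left _ _).trans hy
  set u : ℝ → ℝ := fun y => Real.exp (y ^ 2 / 4) * μ y with hu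
  set u' : ℝ → ℝ := fun y => Real.exp (y ^ 2 / 4) * (deriv μ y + y / 2 * μ y) with hu'
  have hupos : ∀ y, 0 < y → 0 < u y := fun y hy => mul_pos (Real.exp_pos _) (h.pos y hy)
  have d1 : ∀ y, 0 < y → HasDerivAt u (u' y) y := fun y hy => (h.exp_mul hy).1
  have d2 : ∀ y, 0 < y → HasDerivAt u' (y / 2 * u' y + force n y (u y)) y := fun y hy =>
    (h.exp_mul hy).2
  set s : ℝ := -(2 * rate n) with hs
  set W : ℝ → ℝ := fun y =>
    Real.exp (-(y ^ 2 / 4)) * (u' y * (1 * y ^ s) - u y * (1 * s * y ^ s / y)) with hW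
  have he : ∀ y : ℝ, HasDerivAt (fun x : ℝ => Real.exp (-(x ^ 2 / 4)))
      (-(y / 2) * Real.exp (-(y ^ 2 / 4))) y := fun y => by
    convert! hasDerivAt_exp_sq (-(1 / 4)) y using 1
    · ext x; ring_nf
    · ring_nf
  have hWd : ∀ y, 0 < y → HasDerivAt W
      (Real.exp (-(y ^ 2 / 4)) * y ^ s * (coef n y * u y ^ n - u y * (k / y ^ 2))) y := by
    intro y hy
    convert! (he y).mul (((d2 y hy).mul (hasDerivAt_const_mul_rpow 1 s hy)).sub
      ((d1 y hy).mul (hasDerivAt_const_mul_rpow_div (1 * s) s hy))) using 1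
    simp only [force, Pi.sub_apply, Pi.mul_apply]
    generalize y ^ s = Y
    rw [hk, hs]
    field_simp
    ring
  have hWanti : AntitoneOn W (Set.Ici M) := by
    refine antitoneOn_of_deriv_nonpos (convex_Ici M)
      (fun y hy => (hWd y (by linarith [hM5 y hy])).continuousAt.continuousWithinAt)
      (fun y hy => ?_) (fun y hy => ?_)
    all_goals
      rw [interior_Ici] at hy
      have hy5 := hM5 y (Set.Ioi_subset_Ici_self hy)
      have hy0 : 0 < y := by linarith
    · exact (hWd y hy0).differentiableAt.differentiableWithinAt
    · rw [(hWd y hy0).deriv]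
      have hY : 0 < y ^ s := Real.rpow_pos_of_pos hy0 _
      refine mul_nonpos_of_nonneg_of_nonpos (by positivity) ?_
      have hup := hupos y hy0
      have huK : u y ≤ K := by
        have h1 : y ^ s ≤ 1 := Real.rpow_le_one_of_one_le_of_nonpos (by linarith) (by linarith)
        exact (hK y hy5).trans (mul_le_of_le_one_right hK0.le h1)
      have h2 := hM₀ y (hMM y (Set.Ioi_subset_Ici_self hy))
      have h3 : coef n y * u y ^ (n - 1) ≤ k / y ^ 2 := by
        rw [le_div_iff₀ (by positivity)]
        refine le_trans ?_ h2.le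
        have := (coef_pos (n := n) hy0).le
        gcongr
      have h4 : u y ^ n = u y ^ (n - 1) * u y := by
        rw [← pow_succ, Nat.sub_add_cancel (by omega)]
      have h5 := mul_le_mul_of_nonneg_right h3 hup.le
      rw [h4]
      linarith
  set q : ℝ → ℝ := fun y => u y * y ^ (2 * rate n) with hq
  have hqmono : MonotoneOn q (Set.Ici M) := by
    refine monotoneOn_of_antitoneOn_factor (W := W)
      (m := fun y => Real.exp (y ^ 2 / 4) * (y ^ (2 * rate n)) ^ 2) (fun y hy => ?_) hWanti
      (fun y hy => ?_) (fun y hy => ?_)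
    all_goals
      have hy5 := hM5 y hy
      have hy0 : 0 < y := by linarith
      have hZ : 0 < y ^ (2 * rate n) := Real.rpow_pos_of_pos hy0 _
    · have hYZ : y ^ s = (y ^ (2 * rate n))⁻¹ := by rw [hs, Real.rpow_neg hy0.le]
      have hee : Real.exp (-(y ^ 2 / 4)) * Real.exp (y ^ 2 / 4) = 1 := by
        rw [← Real.exp_add]; simp
      have h1 := (d1 y hy0).mul (hasDerivAt_const_mul_rpow 1 (2 * rate n) hy0)
      have h2 : W y * (Real.exp (y ^ 2 / 4) * (y ^ (2 * rate n)) ^ 2)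
          = (Real.exp (-(y ^ 2 / 4)) * Real.exp (y ^ 2 / 4)) *
            ((u' y * (1 * y ^ s) - u y * (1 * s * y ^ s / y)) * (y ^ (2 * rate n)) ^ 2) := by
        simp only [hW]; ring
      rw [h2, hee, hYZ, hs]
      convert! h1 using 1
      · ext x
        simp [hq]
      · field_simp
        ring
    · have h1 : 1 ≤ y ^ (2 * rate n) := Real.one_le_rpow (by linarith) (by linarith)
      have h2 : 1 ≤ Real.exp (y ^ 2 / 4) := Real.one_le_exp (by positivity)
      have h3 : 1 ≤ (y ^ (2 * rate n)) ^ 2 := one_le_pow₀ h1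
      nlinarith
    · exact mul_pos (hupos y hy0) hZ
  have hqK : ∀ y ∈ Set.Ici M, q y ≤ K := by
    intro y hy
    have hy5 := hM5 y hy
    have hy0 : 0 < y := by linarith
    have hZ : 0 < y ^ (2 * rate n) := Real.rpow_pos_of_pos hy0 _
    have h1 := mul_le_mul_of_nonneg_right (hK y hy5) hZ.le
    rwa [mul_assoc K, ← Real.rpow_add hy0, neg_add_cancel, Real.rpow_zero, mul_one] at h1
  have hmax : ∀ y, max M y ∈ Set.Ici M := fun y => Set.mem_Ici.2 (le_max_left _ _)
  have hmono : Monotone fun y => q (max M y) := fun x y hxy =>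
    hqmono (hmax x) (hmax y) (max_le_max le_rfl hxy)
  have hbdd : BddAbove (Set.range fun y => q (max M y)) := ⟨K, by
    rintro _ ⟨y, rfl⟩
    exact hqK _ (hmax y)⟩
  refine ⟨⨆ y, q (max M y), ?_, (tendsto_atTop_ciSup hmono hbdd).congr' ?_⟩
  · refine lt_of_lt_of_le ?_ (le_ciSup hbdd M)
    have : 0 < max M M := by
      have := hM5 _ (hmax M)
      linarith
    exact mul_pos (hupos _ this) (Real.rpow_pos_of_pos this _)
  · filter_upwards [eventually_ge_atTop M] with y hy
    rw [max_eq_right hy]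

theorem IsPositiveSolution.tendsto_exp_mul_atTop (hn : 4 ≤ n) {μ : ℝ → ℝ}
    (h : IsPositiveSolution n μ) :
    Tendsto (fun y => Real.exp (y ^ 2 / 4) * μ y) atTop (𝓝 0) := by
  obtain ⟨K, hK0, hK⟩ := h.exp_mul_le hn
  have h1 := (tendsto_rpow_neg_atTop (y := 2 * rate n) (by linarith [rate_pos hn])).const_mul K
  rw [mul_zero] at h1
  refine squeeze_zero' ?_ ?_ h1
  · filter_upwards [eventually_gt_atTop 0] with y hy
    exact (mul_pos (Real.exp_pos _) (h.pos y hy)).le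
  · filter_upwards [eventually_ge_atTop 5] with y hy using hK y hy

theorem IsPositiveSolution.hasExpansionNearInfinity (hn : 4 ≤ n) {μ : ℝ → ℝ}
    (h : IsPositiveSolution n μ) : ∃ C : ℝ, 0 < C ∧
      HasExpansionNearInfinity (fun y : ℝ => Real.exp (y ^ 2 / 4) * μ y)
        ![C] ![1 - 2 * eps n] := by
  obtain ⟨C, hC0, hC⟩ := h.exists_tendsto_atTop hn
  have : Subsingleton (Fin (0 + 1)) := inferInstanceAs (Subsingleton (Fin 1))
  refine ⟨C, hC0, Subsingleton.strictMono _, ?_⟩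
  have h1 : 2 * rate n = 1 - 2 * eps n := by rw [rate]; ring
  rw [h1] at hC
  have h2 := (hC.sub_const C).abs
  rw [sub_self, abs_zero] at h2
  refine h2.congr' ?_
  filter_upwards [eventually_gt_atTop 0] with y hy
  have hZ : 0 < y ^ (1 - 2 * eps n) := Real.rpow_pos_of_pos hy _
  have h3 : y ^ (-(1 - 2 * eps n)) * y ^ (1 - 2 * eps n) = 1 := by
    rw [← Real.rpow_add hy, neg_add_cancel, Real.rpow_zero]
  change _ = y ^ (1 - 2 * eps n) * |Real.exp (y ^ 2 / 4) * μ y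
    - ∑ i : Fin 1, ![C] i * y ^ (-![1 - 2 * eps n] i)|
  rw [Fin.sum_univ_one]
  change _ = y ^ (1 - 2 * eps n) * |Real.exp (y ^ 2 / 4) * μ y - C * y ^ (-(1 - 2 * eps n))|
  rw [← abs_of_pos hZ, ← abs_mul, abs_of_pos hZ]
  congr 1
  linear_combination C * h3

end NearInfinity

/-! ### Uniqueness -/

theorem IsPositiveSolution.tendsto_sub_nhdsGT {n : ℕ} (hn : 4 ≤ n) {μ ν : ℝ → ℝ}
    (hμ : IsPositiveSolution n μ) (hν : IsPositiveSolution n ν) :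
    Tendsto (fun y => μ y - ν y) (𝓝[>] 0) (𝓝 0) := by
  obtain ⟨y₁, K₁, hy₁, h1⟩ := hμ.abs_sub_approx_le hn
  obtain ⟨y₂, K₂, hy₂, h2⟩ := hν.abs_sub_approx_le hn
  have hθ : 0 < 5 - del n := by linarith [del_le_two hn]
  have h3 : Tendsto (fun y : ℝ => (K₁ + K₂) * y ^ (5 - del n)) (𝓝[>] 0) (𝓝 0) := by
    have h4 := (Real.continuousAt_rpow_const 0 (5 - del n) (Or.inr hθ.le)).tendsto.mono_left
      (nhdsWithin_le_nhds (s := Set.Ioi 0))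
    rw [Real.zero_rpow hθ.ne'] at h4
    simpa using h4.const_mul (K₁ + K₂)
  refine squeeze_zero_norm' ?_ h3
  filter_upwards [Ioc_mem_nhdsGT hy₁, Ioc_mem_nhdsGT hy₂] with y hy hy'
  have e1 := abs_le.1 (h1 y hy)
  have e2 := abs_le.1 (h2 y hy')
  rw [Real.norm_eq_abs, abs_le]
  constructor <;> linarith [e1.1, e1.2, e2.1, e2.2]

theorem IsPositiveSolution.le {n : ℕ} (hn : 4 ≤ n) {μ ν : ℝ → ℝ}
    (hμ : IsPositiveSolution n μ) (hν : IsPositiveSolution n ν) {y : ℝ} (hy : 0 < y) :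
    μ y ≤ ν y := by
  have h0 : Tendsto (fun y => Real.exp (y ^ 2 / 4) * μ y - Real.exp (y ^ 2 / 4) * ν y)
      (𝓝[>] 0) (𝓝 0) := by
    have h1 := (continuous_exp_sq_div.tendsto 0).mono_left (nhdsWithin_le_nhds (s := Set.Ioi 0))
    have h2 := h1.mul (hμ.tendsto_sub_nhdsGT hn hν)
    rw [mul_zero] at h2
    exact h2.congr fun y => by ring
  have hinf := (hμ.tendsto_exp_mul_atTop hn).sub (hν.tendsto_exp_mul_atTop hn)
  rw [sub_self] at hinf
  have key := nonpos_of_strict_subsolution_of_ends (U := Set.Ioi 0) (b := fun y => -(y / 2))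
    (d := fun x => Real.exp (x ^ 2 / 4) * μ x - Real.exp (x ^ 2 / 4) * ν x)
    (fun x hx => (hμ.exp_mul hx).1.sub (hν.exp_mul hx).1)
    (fun x hx => (hμ.exp_mul hx).2.sub (hν.exp_mul hx).2)
    (fun x (hx : 0 < x) hd => by
      have h1 := force_strictMono hn hx (mul_pos (Real.exp_pos _) (hν.pos x hx)).le
        (sub_pos.1 hd)
      linarith)
    (fun x (hx : 0 < x) c hc => by
      obtain ⟨α, hα1, hα2, hα0⟩ := ((h0.eventually_lt_const hc).and
        (Filter.mem_of_superset (Ioo_mem_nhdsGT hx) fun z (hz : z ∈ Set.Ioo 0 x) =>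
          show z < x ∧ 0 < z from ⟨hz.2, hz.1⟩)).exists
      obtain ⟨β, hβ1, hβ2⟩ := ((hinf.eventually_lt_const hc).and (eventually_ge_atTop x)).exists
      exact ⟨α, β, hα2.le, hβ2, fun t ht => hα0.trans_le ht.1, hα1.le, hβ1.le⟩) y hy
  have h5 : Real.exp (y ^ 2 / 4) * μ y ≤ Real.exp (y ^ 2 / 4) * ν y := by linarith
  exact le_of_mul_le_mul_left h5 (Real.exp_pos _)

end ReactionFront

end

theorem proposition3p2 (n : ℕ) (hn : 4 ≤ n) :
    0 < ReactionFront.lam0 n ∧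
    ∃ μ₂ : ℝ → ℝ,
      ReactionFront.IsPositiveSolution n μ₂ ∧
      (∀ ν : ℝ → ℝ, ReactionFront.IsPositiveSolution n ν → Set.EqOn ν μ₂ (Set.Ioi 0)) ∧
      (∃ lam1 : ℝ, lam1 ≠ 0 ∧
        ReactionFront.HasExpansionNearZero μ₂
          ![ReactionFront.lam n, ReactionFront.lam0 n, lam1]
          ![-ReactionFront.del n, 2 - ReactionFront.del n, 4 - ReactionFront.del n]) ∧
      (∃ C : ℝ, 0 < C ∧
        ReactionFront.HasExpansionNearInfinity (fun y : ℝ => Real.exp (y ^ 2 / 4) * μ₂ y)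
          ![C] ![1 - 2 * ReactionFront.eps n]) := by
  obtain ⟨μ, hμ⟩ := ReactionFront.exists_isPositiveSolution hn
  exact ⟨ReactionFront.lam0_pos hn, μ, hμ,
    fun ν hν y hy => le_antisymm (hν.le hn hμ hy) (hμ.le hn hν hy),
    ⟨_, mul_ne_zero (ReactionFront.lam_pos hn).ne' (ReactionFront.relLam1_ne_zero hn),
      hμ.hasExpansionNearZero hn⟩,
    hμ.hasExpansionNearInfinity hn⟩
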